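/- Let $n\ge 1$ and $s\ge 2$ be integers, let $M$ be a smooth manifold of dimension $2n+s$ with a Riemannian metric $g$ and Levi-Civita connection $\nabla$, and let $\mathfrak X_M$ be the set of smooth vector fields on $M$. Let $f,Q$ be smooth $(1,1)$-tensors, $\xi_1,\dots,\xi_s$ smooth vector fields and $\eta^1,\dots,\eta^s$ smooth 1-forms on $M$ such that $f$ has rank $2n$, $Q$ is nonsingular, the distribution $\bigcap_i\ker\eta^i$ is $f$-invariant, and for all $X,Y\in\mathfrak X_M$ $$f^3+fQ=0,\quad f^2=-Q+\sum_i\eta^i\otimes\xi_i,\quad \eta^i(\xi_j)=\delta^i_j,\quad Q\xi_i=\xi_i,\quad g(fX,fY)=g(X,QY)-\sum_i\eta^i(X)\,\eta^i(Y)$$ (a weak metric $f$-structure). Put $\bar\xi=\sum_i\xi_i$ and $\bar\eta=\sum_i\eta^i$, and let $\beta\ne0$ be a constant. Assume that $M$ is a weak $\beta$-Kenmotsu $f$-manifold, i.e. that for all $X,Y\in\mathfrak X_M$ $$[f,f](X,Y)+2\sum_i d\eta^i(X,Y)\,\xi_i=0,\qquad (\nabla_Xf)Y=\beta\{g(fX,Y)\,\bar\xi-\bar\eta(Y)\,fX\},$$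 where $[f,f](X,Y)=f^2[X,Y]+[fX,fY]-f[fX,Y]-f[X,fY]$ and $d\omega(X,Y)=\frac12\{X(\omega(Y))-Y(\omega(X))-\omega([X,Y])\}$. Let $R_{X,Y}=[\nabla_X,\nabla_Y]-\nabla_{[X,Y]}$, $\mathrm{Ric}(X,Y)=\mathrm{trace}(Z\mapsto R_{Z,X}Y)$, $g(\mathrm{Ric}^\sharp X,Y)=\mathrm{Ric}(X,Y)$ and $r=\mathrm{trace}_g\mathrm{Ric}$. Then $\mathrm{Ric}^\sharp X$ (for every $X\in\mathfrak X_M$) and $r$ are differentiable, and for every $1\le i\le s$ and all $X,Y\in\mathfrak X_M$ $$R_{X,Y}\,\xi_i=\beta^2\Big\{\bar\eta(X)Y-\bar\eta(Y)X+\sum_p\big(\bar\eta(Y)\eta^p(X)-\bar\eta(X)\eta^p(Y)\big)\xi_p\Big\},$$ $$\mathrm{Ric}^\sharp\xi_i=-2n\beta^2\,\bar\xi,$$ $$(\nabla_{\xi_i}\mathrm{Ric}^\sharp)X=-2\beta\,\mathrm{Ric}^\sharp X-4n\beta^3\Big\{s\Big(X-\sum_j\eta^j(X)\,\xi_j\Big)+\bar\eta(X)\,\bar\xi\Big\},$$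 $$\xi_i(r)=-2\beta\big(r+2sn(2n+1)\beta^2\big).$$ -/

import Mathlib

open Bundle VectorField Module
open scoped Manifold ContDiff

namespace WeakKenmotsu

variable {E : Type*} [NormedAddCommGroup E] [NormedSpace ℝ E] [FiniteDimensional ℝ E]
  {H : Type*} [TopologicalSpace H] {I : ModelWithCorners ℝ E H}
  {M : Type*} [TopologicalSpace M] [ChartedSpace H M] [IsManifold I ∞ M]
  [RiemannianBundle (fun x : M ↦ TangentSpace I x)]

instance (x : M) : FiniteDimensional ℝ (TangentSpace I x) :=
  inferInstanceAs (FiniteDimensional ℝ E)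

/-- An orthonormal basis of the tangent space `T_x M` with respect to the metric `g_x`. -/
noncomputable def frame (x : M) :
    OrthonormalBasis (Fin (finrank ℝ (TangentSpace I x))) ℝ (TangentSpace I x) :=
  stdOrthonormalBasis ℝ (TangentSpace I x)

/-- The Koszul expression: half of
`X g(Y,Z) + Y g(Z,X) - Z g(X,Y) + g([X,Y],Z) - g([Y,Z],X) + g([Z,X],Y)`, at the point `x`. -/
noncomputable def koszul (X Y Z : Π x : M, TangentSpace I x) (x : M) : ℝ :=
  (1 / 2) * (d% (fun y ↦ inner ℝ (Y y) (Z y)) x (X x) + d% (fun y ↦ inner ℝ (Z y) (X y)) x (Y x)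
    - d% (fun y ↦ inner ℝ (X y) (Y y)) x (Z x)
    + inner ℝ (mlieBracket I X Y x) (Z x) - inner ℝ (mlieBracket I Y Z x) (X x)
    + inner ℝ (mlieBracket I Z X x) (Y x))

variable [IsContMDiffRiemannianBundle I ∞ E (fun x : M ↦ TangentSpace I x)]

theorem mdifferentiableAt_inner {X Y : Π x : M, TangentSpace I x} {x : M}
    (hX : MDiffAt (T% X) x) (hY : MDiffAt (T% Y) x) :
    MDiffAt (fun y ↦ (inner ℝ (X y) (Y y) : ℝ)) x :=
  MDifferentiableAt.inner_bundle (F := E) (E := fun x : M ↦ TangentSpace I x) hX hY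

theorem koszul_tensorial₁ {Y Z : Π x : M, TangentSpace I x} {x : M}
    (hY : MDiffAt (T% Y) x) (hZ : MDiffAt (T% Z) x) :
    TensorialAt I E (fun X ↦ koszul X Y Z x) x where
  smul {f X} hf hX := by
    have h1 : d% (fun y ↦ inner ℝ (Z y) ((f • X) y)) x
        = f x • d% (fun y ↦ inner ℝ (Z y) (X y)) x + inner ℝ (Z x) (X x) • d% f x := by
      have := mvfderiv_mul hf (mdifferentiableAt_inner hZ hX)
      rw [← this]
      congr 1
      ext y; simp [inner_smul_right]
    have h2 : d% (fun y ↦ inner ℝ ((f • X) y) (Y y)) x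
        = f x • d% (fun y ↦ inner ℝ (X y) (Y y)) x + inner ℝ (X x) (Y x) • d% f x := by
      have := mvfderiv_mul hf (mdifferentiableAt_inner hX hY)
      rw [← this]
      congr 1
      ext y; simp [inner_smul_left]
    simp only [koszul, h1, h2, mlieBracket_smul_left hf hX, mlieBracket_smul_right hf hX]
    simp [inner_add_left, inner_smul_left, inner_smul_right, real_inner_comm]
    ring
  add {X X'} hX hX' := by
    have h1 : d% (fun y ↦ inner ℝ (Z y) ((X + X') y)) x
        = d% (fun y ↦ inner ℝ (Z y) (X y)) x + d% (fun y ↦ inner ℝ (Z y) (X' y)) x := by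
      rw [← mvfderiv_add (mdifferentiableAt_inner hZ hX) (mdifferentiableAt_inner hZ hX')]
      congr 1
      ext y; simp [inner_add_right]
    have h2 : d% (fun y ↦ inner ℝ ((X + X') y) (Y y)) x
        = d% (fun y ↦ inner ℝ (X y) (Y y)) x + d% (fun y ↦ inner ℝ (X' y) (Y y)) x := by
      rw [← mvfderiv_add (mdifferentiableAt_inner hX hY) (mdifferentiableAt_inner hX' hY)]
      congr 1
      ext y; simp [inner_add_left]
    simp only [koszul, h1, h2, mlieBracket_add_left hX hX', mlieBracket_add_right hX hX']
    simp [inner_add_left, inner_add_right]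
    ring

theorem koszul_tensorial₃ {X Y : Π x : M, TangentSpace I x} {x : M}
    (hX : MDiffAt (T% X) x) (hY : MDiffAt (T% Y) x) :
    TensorialAt I E (fun Z ↦ koszul X Y Z x) x where
  smul {f Z} hf hZ := by
    have h1 : d% (fun y ↦ inner ℝ (Y y) ((f • Z) y)) x
        = f x • d% (fun y ↦ inner ℝ (Y y) (Z y)) x + inner ℝ (Y x) (Z x) • d% f x := by
      rw [← mvfderiv_mul hf (mdifferentiableAt_inner hY hZ)]
      congr 1
      ext y; simp [inner_smul_right]
    have h2 : d% (fun y ↦ inner ℝ ((f • Z) y) (X y)) x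
        = f x • d% (fun y ↦ inner ℝ (Z y) (X y)) x + inner ℝ (Z x) (X x) • d% f x := by
      rw [← mvfderiv_mul hf (mdifferentiableAt_inner hZ hX)]
      congr 1
      ext y; simp [inner_smul_left]
    simp only [koszul, h1, h2, mlieBracket_smul_left hf hZ, mlieBracket_smul_right hf hZ]
    simp [inner_add_left, inner_smul_left, inner_smul_right, real_inner_comm]
    ring
  add {Z Z'} hZ hZ' := by
    have h1 : d% (fun y ↦ inner ℝ (Y y) ((Z + Z') y)) x
        = d% (fun y ↦ inner ℝ (Y y) (Z y)) x + d% (fun y ↦ inner ℝ (Y y) (Z' y)) x := by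
      rw [← mvfderiv_add (mdifferentiableAt_inner hY hZ) (mdifferentiableAt_inner hY hZ')]
      congr 1
      ext y; simp [inner_add_right]
    have h2 : d% (fun y ↦ inner ℝ ((Z + Z') y) (X y)) x
        = d% (fun y ↦ inner ℝ (Z y) (X y)) x + d% (fun y ↦ inner ℝ (Z' y) (X y)) x := by
      rw [← mvfderiv_add (mdifferentiableAt_inner hZ hX) (mdifferentiableAt_inner hZ' hX)]
      congr 1
      ext y; simp [inner_add_left]
    simp only [koszul, h1, h2, mlieBracket_add_left hZ hZ', mlieBracket_add_right hZ hZ']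
    simp [inner_add_left, inner_add_right]
    ring

open scoped Classical in
/-- For a field `Y` differentiable at `x`, the bilinear form on `T_x M` that sends `(X x, Z x)` to
the Koszul expression of `(X, Y, Z)` at `x` (zero if `Y` is not differentiable at `x`). -/
noncomputable def koszulForm (Y : Π x : M, TangentSpace I x) (x : M) :
    TangentSpace I x →L[ℝ] TangentSpace I x →L[ℝ] ℝ :=
  if hY : MDiffAt (T% Y) x then
    TensorialAt.mkHom₂ (fun X Z ↦ koszul X Y Z x) x
      (fun _ hZ ↦ koszul_tensorial₁ hY hZ) (fun _ hX ↦ koszul_tensorial₃ hX hY)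
  else 0

theorem koszulForm_apply {X Y Z : Π x : M, TangentSpace I x} {x : M}
    (hX : MDiffAt (T% X) x) (hY : MDiffAt (T% Y) x) (hZ : MDiffAt (T% Z) x) :
    koszulForm Y x (X x) (Z x) = koszul X Y Z x := by
  rw [koszulForm, dif_pos hY]
  exact TensorialAt.mkHom₂_apply (Φ := fun X Z ↦ koszul X Y Z x)
    (fun _ hZ ↦ koszul_tensorial₁ hY hZ) (fun _ hX ↦ koszul_tensorial₃ hX hY) hX hZ

/-- The linear map `u ↦ (∇_u Y)(x)`: the Koszul form with its last argument turned into a vector by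
the metric. -/
noncomputable def nabla (Y : Π x : M, TangentSpace I x) (x : M) :
    TangentSpace I x →L[ℝ] TangentSpace I x :=
  ∑ a, ((koszulForm Y x).flip (frame x a)).smulRight (frame x a)

theorem inner_nabla (Y : Π x : M, TangentSpace I x) (x : M) (u w : TangentSpace I x) :
    inner ℝ (nabla Y x u) w = koszulForm Y x u w := by
  conv_rhs => rw [← (frame x).sum_repr' w]
  simp [nabla, sum_inner, inner_smul_left, mul_comm]

theorem inner_nabla_eq_koszul {X Y Z : Π x : M, TangentSpace I x} {x : M}
    (hX : MDiffAt (T% X) x) (hY : MDiffAt (T% Y) x) (hZ : MDiffAt (T% Z) x) :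
    inner ℝ (nabla Y x (X x)) (Z x) = koszul X Y Z x := by
  rw [inner_nabla, koszulForm_apply hX hY hZ]

theorem ext_inner_extend {x : M} {A B : TangentSpace I x →L[ℝ] TangentSpace I x}
    (h : ∀ X Z : Π x : M, TangentSpace I x, MDiffAt (T% X) x → MDiffAt (T% Z) x →
      (inner ℝ (A (X x)) (Z x) : ℝ) = inner ℝ (B (X x)) (Z x)) : A = B := by
  ext u
  refine ext_inner_right ℝ fun w ↦ ?_
  have := h (FiberBundle.extend E u) (FiberBundle.extend E w)
    (FiberBundle.mdifferentiableAt_extend ..) (FiberBundle.mdifferentiableAt_extend ..)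
  simpa using this

/-- The Levi-Civita connection of the Riemannian metric. The argument order is that of Mathlib:
`leviCivita Y x (X x)` is `(∇_X Y)(x)`. -/
noncomputable def leviCivita : CovariantDerivative I E (fun x : M ↦ TangentSpace I x) where
  toFun := nabla
  isCovariantDerivativeOnUniv :=
    { add := by
        intro Y Y' x hY hY' _
        refine ext_inner_extend fun X Z hX hZ ↦ ?_
        have hYY : MDiffAt (T% (Y + Y')) x := mdifferentiableAt_add_section hY hY'
        rw [inner_nabla_eq_koszul hX hYY hZ, add_apply, inner_add_left,
          inner_nabla_eq_koszul hX hY hZ, inner_nabla_eq_koszul hX hY' hZ]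
        have h1 : d% (fun y ↦ inner ℝ ((Y + Y') y) (Z y)) x
            = d% (fun y ↦ inner ℝ (Y y) (Z y)) x + d% (fun y ↦ inner ℝ (Y' y) (Z y)) x := by
          rw [← mvfderiv_add (mdifferentiableAt_inner hY hZ) (mdifferentiableAt_inner hY' hZ)]
          congr 1
          ext y; simp [inner_add_left]
        have h2 : d% (fun y ↦ inner ℝ (X y) ((Y + Y') y)) x
            = d% (fun y ↦ inner ℝ (X y) (Y y)) x + d% (fun y ↦ inner ℝ (X y) (Y' y)) x := by
          rw [← mvfderiv_add (mdifferentiableAt_inner hX hY) (mdifferentiableAt_inner hX hY')]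
          congr 1
          ext y; simp [inner_add_right]
        simp only [koszul, h1, h2, mlieBracket_add_left hY hY', mlieBracket_add_right hY hY']
        simp [inner_add_left, inner_add_right]
        ring
      leibniz := by
        intro Y f x hY hf _
        refine ext_inner_extend fun X Z hX hZ ↦ ?_
        have hfY : MDiffAt (T% (f • Y)) x := hf.smul_section hY
        rw [inner_nabla_eq_koszul hX hfY hZ]
        simp only [add_apply, inner_add_left, smul_apply,
          ContinuousLinearMap.smulRight_apply, inner_smul_left]
        rw [inner_nabla_eq_koszul hX hY hZ]
        have h1 : d% (fun y ↦ inner ℝ ((f • Y) y) (Z y)) x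
            = f x • d% (fun y ↦ inner ℝ (Y y) (Z y)) x + inner ℝ (Y x) (Z x) • d% f x := by
          rw [← mvfderiv_mul hf (mdifferentiableAt_inner hY hZ)]
          congr 1
          ext y; simp [inner_smul_left]
        have h2 : d% (fun y ↦ inner ℝ (X y) ((f • Y) y)) x
            = f x • d% (fun y ↦ inner ℝ (X y) (Y y)) x + inner ℝ (X x) (Y x) • d% f x := by
          rw [← mvfderiv_mul hf (mdifferentiableAt_inner hX hY)]
          congr 1
          ext y; simp [inner_smul_right]
        simp only [koszul, h1, h2, mlieBracket_smul_left hf hY, mlieBracket_smul_right hf hY]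
        simp [inner_add_left, inner_smul_left, inner_smul_right, real_inner_comm]
        ring }

/-- The Levi-Civita connection is torsion free. -/
theorem leviCivita_torsion {X Y : Π x : M, TangentSpace I x} {x : M}
    (hX : MDiffAt (T% X) x) (hY : MDiffAt (T% Y) x) :
    leviCivita Y x (X x) - leviCivita X x (Y x) = mlieBracket I X Y x := by
  refine ext_inner_right ℝ fun w ↦ ?_
  have hZ := FiberBundle.mdifferentiableAt_extend I E w
  have hw : w = FiberBundle.extend E w x := by simp
  rw [hw, inner_sub_left]
  change inner ℝ (nabla Y x (X x)) _ - inner ℝ (nabla X x (Y x)) _ = _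
  rw [inner_nabla_eq_koszul hX hY hZ, inner_nabla_eq_koszul hY hX hZ]
  simp only [koszul]
  rw [mlieBracket_swap_apply (V := Y) (W := X),
    mlieBracket_swap_apply (V := FiberBundle.extend E w) (W := X),
    mlieBracket_swap_apply (V := FiberBundle.extend E w) (W := Y)]
  simp only [real_inner_comm, inner_neg_left]
  ring

/-- The Levi-Civita connection is compatible with the metric. -/
theorem leviCivita_metric {X Y Z : Π x : M, TangentSpace I x} {x : M}
    (hX : MDiffAt (T% X) x) (hY : MDiffAt (T% Y) x) (hZ : MDiffAt (T% Z) x) :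
    d% (fun y ↦ (inner ℝ (Y y) (Z y) : ℝ)) x (X x)
      = inner ℝ (leviCivita Y x (X x)) (Z x) + inner ℝ (Y x) (leviCivita Z x (X x)) := by
  rw [real_inner_comm (leviCivita Z x (X x))]
  change _ = inner ℝ (nabla Y x (X x)) _ + inner ℝ (nabla Z x (X x)) _
  rw [inner_nabla_eq_koszul hX hY hZ, inner_nabla_eq_koszul hX hZ hY]
  simp only [koszul]
  rw [mlieBracket_swap_apply (V := Z) (W := Y), mlieBracket_swap_apply (V := Y) (W := X),
    mlieBracket_swap_apply (V := Z) (W := X)]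
  simp only [real_inner_comm, inner_neg_left]
  ring

/-! ### Curvature -/

/-- The curvature operator `R_{X,Y} Z = ∇_X ∇_Y Z - ∇_Y ∇_X Z - ∇_{[X,Y]} Z` on vector fields. -/
noncomputable def curvature (X Y Z : Π x : M, TangentSpace I x) (x : M) : TangentSpace I x :=
  leviCivita (fun y ↦ leviCivita Z y (Y y)) x (X x)
    - leviCivita (fun y ↦ leviCivita Z y (X y)) x (Y x)
    - leviCivita Z x (mlieBracket I X Y x)

/-- The curvature tensor at `x`, evaluated on tangent vectors: the curvature operator applied to
extensions of the vectors to vector fields that are smooth near `x`. -/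
noncomputable def curvatureAt (x : M) (u v w : TangentSpace I x) : TangentSpace I x :=
  curvature (FiberBundle.extend E u) (FiberBundle.extend E v) (FiberBundle.extend E w) x

/-- The Ricci tensor `Ric(u, v) = trace (z ↦ R_{z,u} v)`, the trace being computed in an orthonormal
basis. -/
noncomputable def ricci (x : M) (u v : TangentSpace I x) : ℝ :=
  ∑ a, inner ℝ (curvatureAt x (frame x a) u v) (frame x a)

/-- The Ricci operator `Ric♯`, that is, the vector `Ric♯ u` with `g(Ric♯ u, v) = Ric(u, v)`, given
by its components `Ric(u, e_a)` in an orthonormal basis. -/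
noncomputable def ricciOp (x : M) (u : TangentSpace I x) : TangentSpace I x :=
  ∑ a, ricci x u (frame x a) • frame x a

variable (I) in
/-- The scalar curvature `r = trace_g Ric`. -/
noncomputable def scalarCurvature (x : M) : ℝ :=
  ∑ a, ricci (I := I) x (frame x a) (frame x a)

/-- The covariant derivative of a field of endomorphisms `T` of the tangent spaces:
`(∇_Z T) X = ∇_Z (T X) - T (∇_Z X)`. -/
noncomputable def nablaEndo (T : Π x : M, TangentSpace I x → TangentSpace I x)
    (Z X : Π x : M, TangentSpace I x) (x : M) : TangentSpace I x :=
  leviCivita (fun y ↦ T y (X y)) x (Z x) - T x (leviCivita X x (Z x))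

/-! ### Weak metric `f`-structures -/

/-- The Nijenhuis torsion
`[S,S](X,Y) = S² [X,Y] + [S X, S Y] - S [S X, Y] - S [X, S Y]`. -/
noncomputable def nijenhuis (S : Π x : M, TangentSpace I x →L[ℝ] TangentSpace I x)
    (X Y : Π x : M, TangentSpace I x) (x : M) : TangentSpace I x :=
  S x (S x (mlieBracket I X Y x))
    + mlieBracket I (fun y ↦ S y (X y)) (fun y ↦ S y (Y y)) x
    - S x (mlieBracket I (fun y ↦ S y (X y)) Y x)
    - S x (mlieBracket I X (fun y ↦ S y (Y y)) x)

/-- The exterior derivative of a 1-form,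
`dθ(X,Y) = (1/2) (X(θ(Y)) - Y(θ(X)) - θ([X,Y]))`. -/
noncomputable def extDeriv (θ : Π x : M, TangentSpace I x →L[ℝ] ℝ)
    (X Y : Π x : M, TangentSpace I x) (x : M) : ℝ :=
  (1 / 2) * (d% (fun y ↦ θ y (Y y)) x (X x) - d% (fun y ↦ θ y (X y)) x (Y x)
    - θ x (mlieBracket I X Y x))

/-- A field of endomorphisms of the tangent spaces is a smooth (1,1)-tensor. -/
def IsSmoothEndo (S : Π x : M, TangentSpace I x →L[ℝ] TangentSpace I x) : Prop :=
  ContMDiff I (I.prod 𝓘(ℝ, E →L[ℝ] E)) ∞ (fun x ↦ TotalSpace.mk' (E →L[ℝ] E) x (S x))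

/-- A field of covectors is a smooth 1-form. -/
def IsSmoothForm (θ : Π x : M, TangentSpace I x →L[ℝ] ℝ) : Prop :=
  ContMDiff I (I.prod 𝓘(ℝ, E →L[ℝ] ℝ)) ∞ (fun x ↦ TotalSpace.mk' (E →L[ℝ] ℝ) x (θ x))

/-- The vector field `ξ̄ = ∑ i, ξ_i`. -/
noncomputable def xiBar {s : ℕ} (ξ : Fin s → Π x : M, TangentSpace I x) (x : M) :
    TangentSpace I x :=
  ∑ i, ξ i x

/-- The 1-form `η̄ = ∑ i, η^i`. -/
noncomputable def etaBar {s : ℕ} (η : Fin s → Π x : M, TangentSpace I x →L[ℝ] ℝ) (x : M) :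
    TangentSpace I x →L[ℝ] ℝ :=
  ∑ i, η i x

/-- A weak `f`-structure on a smooth manifold of dimension `2n + s`. -/
structure IsWeakF (n s : ℕ) (f Q : Π x : M, TangentSpace I x →L[ℝ] TangentSpace I x) :
    Prop where
  n_pos : 0 < n
  one_lt_s : 1 < s
  dim : finrank ℝ E = 2 * n + s
  smooth_f : IsSmoothEndo f
  smooth_Q : IsSmoothEndo Q
  rank_f : ∀ x, finrank ℝ (f x).range = 2 * n
  nonsingular_Q : ∀ x, Function.Bijective (Q x)
  cube : ∀ x u, f x (f x (f x u)) + f x (Q x u) = 0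

/-- A framed weak `f`-structure, with `f`-invariant contact distribution `⋂ i, ker η^i`. -/
structure IsFramedWeakF (n s : ℕ) (f Q : Π x : M, TangentSpace I x →L[ℝ] TangentSpace I x)
    (ξ : Fin s → Π x : M, TangentSpace I x)
    (η : Fin s → Π x : M, TangentSpace I x →L[ℝ] ℝ) : Prop extends IsWeakF n s f Q where
  smooth_ξ : ∀ i, CMDiff ∞ (T% (ξ i))
  smooth_η : ∀ i, IsSmoothForm (η i)
  sq : ∀ x u, f x (f x u) = -Q x u + ∑ i, η i x u • ξ i x
  η_ξ : ∀ x i j, η i x (ξ j x) = if i = j then 1 else 0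
  Q_ξ : ∀ x i, Q x (ξ i x) = ξ i x
  invariant : ∀ x u, (∀ i, η i x u = 0) → ∀ i, η i x (f x u) = 0

/-- A weak metric `f`-structure: a framed weak `f`-structure for which the Riemannian metric is
compatible. -/
structure IsWeakMetricF (n s : ℕ) (f Q : Π x : M, TangentSpace I x →L[ℝ] TangentSpace I x)
    (ξ : Fin s → Π x : M, TangentSpace I x)
    (η : Fin s → Π x : M, TangentSpace I x →L[ℝ] ℝ) : Prop
    extends IsFramedWeakF n s f Q ξ η where
  compatible : ∀ (x : M) (u v : TangentSpace I x),
    (inner ℝ (f x u) (f x v) : ℝ) = inner ℝ u (Q x v) - ∑ i, η i x u * η i x v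

/-- A weak `β`-Kenmotsu `f`-manifold: a weak metric `f`-manifold that is normal, with
`(∇_X f) Y = β (g(f X, Y) ξ̄ - η̄(Y) f X)` for a smooth function `β` without zeros. -/
structure IsWeakKenmotsuF (n s : ℕ) (f Q : Π x : M, TangentSpace I x →L[ℝ] TangentSpace I x)
    (ξ : Fin s → Π x : M, TangentSpace I x)
    (η : Fin s → Π x : M, TangentSpace I x →L[ℝ] ℝ) (β : M → ℝ) : Prop
    extends IsWeakMetricF n s f Q ξ η where
  normal : ∀ X Y : Π x : M, TangentSpace I x, CMDiff ∞ (T% X) → CMDiff ∞ (T% Y) → ∀ x,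
    nijenhuis f X Y x + ∑ i, (2 * extDeriv (η i) X Y x) • ξ i x = 0
  smooth_β : CMDiff ∞ β
  β_ne_zero : ∀ x, β x ≠ 0
  kenmotsu : ∀ X Y : Π x : M, TangentSpace I x, CMDiff ∞ (T% X) → CMDiff ∞ (T% Y) → ∀ x,
    nablaEndo (fun y u ↦ f y u) X Y x
      = β x • ((inner ℝ (f x (X x)) (Y x) : ℝ) • xiBar ξ x - etaBar η x (Y x) • f x (X x))

end WeakKenmotsu

/-!
Normality and `g(fX, fY) = g(X, QY) - ∑ η^i(X) η^i(Y)` make the `ξ_i` orthonormal with dual forms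
`η^i`, and the equation for `∇f` then gives `∇_X ξ_i = β P X`, where `P X = X - ∑ η^p(X) ξ_p`: the
only unknown components are `c_{ijk} = ⟪∇_{ξ_i} ξ_j, ξ_k⟫`, and normality, in the form
`dη^k(·, ξ_j) = 0`, gives `c_{ijk} = -c_{jki}`, hence `c_{ijk} = -c_{ijk}`. Everything else
follows from this equation. Differentiating it yields `R_{X,Y} ξ_i`, and by the pair symmetry of `R`
also `R_{ξ_i,Y} Z`. The second Bianchi identity with one argument `ξ_i` expresses `∇_{ξ_i} R`
through derivatives of these known terms; its traces are the formulas for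
`∇_{ξ_i} Ric♯` and `ξ_i(r)`.

The argument up to these traces is algebra over the ring of smooth functions, carried out for an
abstract module with a bracket, a metric, its Levi-Civita connection and a trace.
-/

/-- The algebraic structure carried by the vector fields `L` of a Riemannian manifold over the ring
`R` of smooth functions: a Lie–Rinehart algebra with a metric and its Levi-Civita connection. The
bracket is not a separate datum but `∇_X Y - ∇_Y X`, and `trace` is the trace of tensors of type
`(1,1)`, which exists although `L` need not be free. -/
structure MetricLieRinehart (R L : Type*) [CommRing R] [AddCommGroup L] [Module R L] where
  /-- The derivative of a function along a vector field. -/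
  D : L →ₗ[R] Derivation ℤ R R
  /-- The metric. -/
  g : L →ₗ[R] L →ₗ[R] R
  /-- The Levi-Civita connection. -/
  cov : L →ₗ[R] L →+ L
  /-- The trace of an endomorphism. -/
  trace : (L →ₗ[R] L) →ₗ[R] R
  g_comm : ∀ X Y, g X Y = g Y X
  nondegenerate : ∀ X Y, (∀ Z, g X Z = g Y Z) → X = Y
  leibniz : ∀ X r Y, cov X (r • Y) = r • cov X Y + D X r • Y
  metric : ∀ X Y Z, D X (g Y Z) = g (cov X Y) Z + g Y (cov X Z)
  D_bracket : ∀ X Y r, D (cov X Y - cov Y X) r = D X (D Y r) - D Y (D X r)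
  jacobi : ∀ X Y Z, cov X (cov Y Z - cov Z Y) - cov (cov Y Z - cov Z Y) X =
    (cov (cov X Y - cov Y X) Z - cov Z (cov X Y - cov Y X))
      + (cov Y (cov X Z - cov Z X) - cov (cov X Z - cov Z X) Y)
  trace_smulRight : ∀ (θ : L →ₗ[R] R) X, trace (θ.smulRight X) = θ X
  D_trace : ∀ X (T T' : L →ₗ[R] L), (∀ Y, T' Y = cov X (T Y) - T (cov X Y)) →
    D X (trace T) = trace T'

namespace MetricLieRinehart

variable {R L : Type*} [CommRing R] [AddCommGroup L] [Module R L] (A : MetricLieRinehart R L)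

/-! ### Curvature -/

/-- The curvature operator `R_{X,Y}`. -/
def curv (X Y : L) : L →ₗ[R] L where
  toFun Z := A.cov X (A.cov Y Z) - A.cov Y (A.cov X Z) - A.cov (A.cov X Y - A.cov Y X) Z
  map_add' Z Z' := by
    simp only [map_add]
    abel
  map_smul' r Z := by
    simp only [leibniz, map_add, D_bracket, RingHom.id_apply]
    module

theorem curv_apply (X Y Z : L) : A.curv X Y Z =
    A.cov X (A.cov Y Z) - A.cov Y (A.cov X Z) - A.cov (A.cov X Y - A.cov Y X) Z := rfl

theorem curv_swap (X Y Z : L) : A.curv X Y Z = -A.curv Y X Z := by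
  simp only [curv_apply, map_sub, AddMonoidHom.sub_apply]
  abel

theorem curv_add_left (X X' Y Z : L) : A.curv (X + X') Y Z = A.curv X Y Z + A.curv X' Y Z := by
  simp only [curv_apply, map_add, map_sub, AddMonoidHom.add_apply, AddMonoidHom.sub_apply]
  abel

theorem curv_smul_left (r : R) (X Y Z : L) : A.curv (r • X) Y Z = r • A.curv X Y Z := by
  simp only [curv_apply, map_smul, map_add, map_sub, AddMonoidHom.smul_apply,
    AddMonoidHom.add_apply, AddMonoidHom.sub_apply, leibniz]
  module

/-- The endomorphism `X ↦ R_{X,Y} Z`, whose trace is the Ricci tensor. -/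
def curvEnd (Y Z : L) : L →ₗ[R] L where
  toFun X := A.curv X Y Z
  map_add' X X' := A.curv_add_left X X' Y Z
  map_smul' r X := A.curv_smul_left r X Y Z

@[simp] theorem curvEnd_apply (X Y Z : L) : A.curvEnd Y Z X = A.curv X Y Z := rfl

theorem curvEnd_add (Y Y' Z : L) : A.curvEnd (Y + Y') Z = A.curvEnd Y Z + A.curvEnd Y' Z := by
  ext X
  simp only [curvEnd_apply, LinearMap.add_apply, A.curv_swap X, curv_add_left, neg_add]

theorem curvEnd_smul (r : R) (Y Z : L) : A.curvEnd (r • Y) Z = r • A.curvEnd Y Z := by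
  ext X
  simp only [curvEnd_apply, LinearMap.smul_apply, A.curv_swap X, curv_smul_left, smul_neg]

/-- The Ricci tensor. -/
def ric : L →ₗ[R] L →ₗ[R] R :=
  LinearMap.mk₂ R (fun Y Z ↦ A.trace (A.curvEnd Y Z))
    (fun Y Y' Z ↦ by rw [curvEnd_add, map_add])
    (fun r Y Z ↦ by rw [curvEnd_smul, map_smul])
    (fun Y Z Z' ↦ by rw [← map_add]; congr 1; ext X; simp)
    (fun r Y Z ↦ by rw [← map_smul]; congr 1; ext X; simp)

theorem ric_apply (Y Z : L) : A.ric Y Z = A.trace (A.curvEnd Y Z) := rfl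

theorem first_bianchi (X Y Z : L) : A.curv X Y Z + A.curv Y Z X + A.curv Z X Y = 0 := by
  have h := A.jacobi X Y Z
  simp only [curv_apply, map_sub, AddMonoidHom.sub_apply] at h ⊢
  rw [← sub_eq_zero] at h
  rw [← h]
  abel

theorem g_curv_skew (X Y Z W : L) : A.g (A.curv X Y Z) W = -A.g (A.curv X Y W) Z := by
  have h := A.D_bracket X Y (A.g Z W)
  simp only [metric, map_add] at h
  simp only [A.g_comm _ Z, curv_apply, map_sub A.g, LinearMap.sub_apply] at h ⊢
  linear_combination -h

theorem g_curv_pair [IsAddTorsionFree R] (X Y Z W : L) :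
    A.g (A.curv X Y Z) W = A.g (A.curv Z W X) Y := by
  have bianchi (X Y Z W : L) :
      A.g (A.curv X Y Z) W + A.g (A.curv Y Z X) W + A.g (A.curv Z X Y) W = 0 := by
    simpa using congr(A.g $(A.first_bianchi X Y Z) W)
  have swap (X Y Z W : L) : A.g (A.curv X Y Z) W = -A.g (A.curv Y X Z) W := by
    rw [curv_swap, map_neg, LinearMap.neg_apply]
  refine sub_eq_zero.1 (self_eq_neg.1 (eq_neg_of_add_eq_zero_left ?_))
  linear_combination bianchi X Y Z W + bianchi Y Z W X - bianchi Z W X Y - bianchi W X Y Z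
    - A.g_curv_skew Y Z W X - A.g_curv_skew Z W Y X + A.g_curv_skew W X Z Y
    + A.g_curv_skew X Y W Z + swap X Z W Y - A.g_curv_skew Z X W Y - swap W Y Z X
    + A.g_curv_skew Y W Z X

/-- The covariant derivative `(∇_V R)_{X,Y} Z` of the curvature. -/
def covCurv (V X Y Z : L) : L :=
  A.cov V (A.curv X Y Z) - A.curv (A.cov V X) Y Z - A.curv X (A.cov V Y) Z
    - A.curv X Y (A.cov V Z)

theorem covCurv_swap (V X Y Z : L) : A.covCurv V X Y Z = -A.covCurv V Y X Z := by
  simp only [covCurv, A.curv_swap Y, A.curv_swap (A.cov V Y), map_neg]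
  abel

theorem second_bianchi (V X Y Z : L) :
    A.covCurv V X Y Z + A.covCurv X Y V Z + A.covCurv Y V X Z = 0 := by
  have h := congr(A.cov $(sub_eq_zero.2 (A.jacobi V X Y).symm) Z)
  simp only [covCurv, curv_apply, map_sub, map_add, map_zero, AddMonoidHom.sub_apply,
    AddMonoidHom.add_apply, AddMonoidHom.zero_apply] at h ⊢
  rw [← h]
  abel

/-- The trace over `X` of `∇_V (R_{X,Y} Z)`. -/
theorem D_ric (V Y Z : L) (T : L →ₗ[R] L) (hT : ∀ X, T X = A.covCurv V X Y Z) :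
    A.D V (A.ric Y Z) = A.ric (A.cov V Y) Z + A.ric Y (A.cov V Z) + A.trace T := by
  simp only [ric_apply, ← map_add]
  refine A.D_trace _ _ _ fun X ↦ ?_
  simp only [LinearMap.add_apply, curvEnd_apply, hT, covCurv]
  abel

/-! ### Kenmotsu frames -/

section Projection

variable {ι : Type*} [Fintype ι] (ξ : ι → L)

/-- The projection along the fields `ξ i`: `X ↦ X - ∑ g(ξ_i, X) ξ_i`. -/
def proj : L →ₗ[R] L := LinearMap.id - ∑ i, (A.g (ξ i)).smulRight (ξ i)

theorem proj_apply (X : L) : A.proj ξ X = X - ∑ i, A.g (ξ i) X • ξ i := by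
  simp [proj]

theorem g_proj_comm (X Y : L) : A.g (A.proj ξ X) Y = A.g (A.proj ξ Y) X := by
  simp [proj_apply, A.g_comm X Y, mul_comm]

/-- A Kenmotsu frame: orthonormal fields `ξ i` with `∇_X ξ_i = b (X - ∑ g(ξ_p, X) ξ_p)` for a
constant `b`. -/
structure IsKenmotsuFrame (b : R) : Prop where
  g_self : ∀ i, A.g (ξ i) (ξ i) = 1
  g_of_ne : ∀ i j, i ≠ j → A.g (ξ i) (ξ j) = 0
  D_eq_zero : ∀ X, A.D X b = 0
  cov_eq : ∀ X i, A.cov X (ξ i) = b • A.proj ξ X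

/-- The tensor `(Y, Z) ↦ b² (η̄(Z) PY - g(PY, Z) ξ̄)`, where `P` is the projection along the `ξ i`,
`ξ̄` is their sum and `η̄ = g(ξ̄, ·)`. For a Kenmotsu frame it is `R_{ξ_i,Y} Z`. -/
def frameCurv (b : R) (Y Z : L) : L :=
  b ^ 2 • (A.g (∑ i, ξ i) Z • A.proj ξ Y - A.g (A.proj ξ Y) Z • ∑ i, ξ i)

end Projection

namespace IsKenmotsuFrame

variable {A} {ι : Type*} [Fintype ι] {ξ : ι → L} {b : R} (h : A.IsKenmotsuFrame ξ b)
include h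

theorem g_sum (i : ι) : A.g (ξ i) (∑ j, ξ j) = 1 := by
  rw [map_sum, Finset.sum_eq_single i (fun j _ hj ↦ h.g_of_ne i j hj.symm) (by simp), h.g_self]

theorem g_proj (i : ι) (X : L) : A.g (ξ i) (A.proj ξ X) = 0 := by
  rw [proj_apply, map_sub, map_sum,
    Finset.sum_eq_single i (fun j _ hj ↦ by simp [h.g_of_ne i j hj.symm]) (by simp)]
  simp [h.g_self]

theorem g_sum_proj (X : L) : A.g (∑ i, ξ i) (A.proj ξ X) = 0 := by
  simp [LinearMap.sum_apply, h.g_proj]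

theorem g_sum_sum : A.g (∑ i, ξ i) (∑ i, ξ i) = Fintype.card ι := by
  rw [map_sum]
  simp only [A.g_comm _ (ξ _), h.g_sum, Finset.sum_const, Finset.card_univ, nsmul_one]

theorem proj_proj (X : L) : A.proj ξ (A.proj ξ X) = A.proj ξ X := by
  rw [proj_apply A ξ (A.proj ξ X)]
  simp [h.g_proj]

theorem g_proj_proj (X Y : L) : A.g (A.proj ξ X) (A.proj ξ Y) = A.g (A.proj ξ X) Y := by
  rw [A.g_comm, A.g_proj_comm, h.proj_proj]

theorem cov_sum (X : L) : A.cov X (∑ i, ξ i) = (Fintype.card ι * b) • A.proj ξ X := by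
  simp [h.cov_eq, mul_smul, Nat.cast_smul_eq_nsmul]

theorem cov_proj (X Y : L) : A.cov X (A.proj ξ Y) = A.proj ξ (A.cov X Y)
    - b • (A.g (A.proj ξ X) Y • ∑ i, ξ i + A.g (∑ i, ξ i) Y • A.proj ξ X) := by
  have h_summand (i) : A.cov X (A.g (ξ i) Y • ξ i) = A.g (ξ i) (A.cov X Y) • ξ i
      + b • (A.g (A.proj ξ X) Y • ξ i + A.g (ξ i) Y • A.proj ξ X) := by
    rw [leibniz, metric, h.cov_eq]
    simp only [map_smul, LinearMap.smul_apply, smul_eq_mul]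
    module
  rw [proj_apply, map_sub, map_sum]
  simp only [h_summand, Finset.sum_add_distrib, ← Finset.smul_sum, ← Finset.sum_smul,
    proj_apply A ξ (A.cov X Y), map_sum A.g, LinearMap.sum_apply]
  module

theorem D_g_sum (X Y : L) : A.D X (A.g (∑ i, ξ i) Y) =
    A.g (∑ i, ξ i) (A.cov X Y) + Fintype.card ι * b * A.g (A.proj ξ X) Y := by
  rw [metric, h.cov_sum, map_smul, LinearMap.smul_apply, smul_eq_mul, add_comm]

theorem D_g_proj (X Y Z : L) : A.D X (A.g (A.proj ξ Y) Z) =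
    A.g (A.proj ξ (A.cov X Y)) Z + A.g (A.proj ξ Y) (A.cov X Z)
      - b * (A.g (A.proj ξ X) Y * A.g (∑ i, ξ i) Z
        + A.g (∑ i, ξ i) Y * A.g (A.proj ξ X) Z) := by
  rw [metric, h.cov_proj]
  simp only [map_sub, map_add, map_smul, LinearMap.sub_apply, LinearMap.add_apply,
    LinearMap.smul_apply, smul_eq_mul]
  ring

theorem curv_xi (X Y : L) (i : ι) : A.curv X Y (ξ i) =
    b ^ 2 • (A.g (∑ j, ξ j) X • A.proj ξ Y - A.g (∑ j, ξ j) Y • A.proj ξ X) := by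
  rw [curv_apply]
  simp only [h.cov_eq, leibniz, h.D_eq_zero, h.cov_proj, map_sub (A.proj ξ),
    A.g_proj_comm ξ X Y]
  module

theorem cov_frameCurv (X Y Z : L) : A.cov X (A.frameCurv ξ b Y Z) =
    A.frameCurv ξ b (A.cov X Y) Z + A.frameCurv ξ b Y (A.cov X Z)
      + b ^ 3 • ((Fintype.card ι : R) •
          (A.g (A.proj ξ X) Z • A.proj ξ Y - A.g (A.proj ξ Y) Z • A.proj ξ X)
        - (A.g (∑ i, ξ i) Z * A.g (∑ i, ξ i) Y) • A.proj ξ X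
        + (A.g (∑ i, ξ i) Y * A.g (A.proj ξ X) Z) • ∑ i, ξ i) := by
  have hb : A.D X (b ^ 2) = 0 := by simp [pow_two, h.D_eq_zero]
  simp only [frameCurv, leibniz, hb, map_sub (A.cov X), h.D_g_sum, h.D_g_proj, h.cov_proj,
    h.cov_sum]
  module

variable [IsAddTorsionFree R]

theorem curv_xi_left (Y Z : L) (i : ι) : A.curv (ξ i) Y Z = A.frameCurv ξ b Y Z := by
  refine A.nondegenerate _ _ fun W ↦ ?_
  rw [g_curv_pair, h.curv_xi, frameCurv]
  simp only [map_sub, map_smul, LinearMap.sub_apply, LinearMap.smul_apply, smul_eq_mul,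
    A.g_proj_comm ξ W Y, A.g_proj_comm ξ Z Y]
  ring

theorem curv_proj_left (X Y Z : L) : A.curv (A.proj ξ X) Y Z =
    A.curv X Y Z - A.g (∑ i, ξ i) X • A.frameCurv ξ b Y Z := by
  rw [← curvEnd_apply, proj_apply, map_sub, map_sum]
  simp [h.curv_xi_left, ← Finset.sum_smul, LinearMap.sum_apply]

theorem covCurv_xi_left (X Y Z : L) (i : ι) : A.covCurv X (ξ i) Y Z =
    -b • A.curv X Y Z + (b * A.g (∑ i, ξ i) X) • A.frameCurv ξ b Y Z
      + b ^ 3 • ((Fintype.card ι : R) •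
          (A.g (A.proj ξ X) Z • A.proj ξ Y - A.g (A.proj ξ Y) Z • A.proj ξ X)
        - (A.g (∑ i, ξ i) Z * A.g (∑ i, ξ i) Y) • A.proj ξ X
        + (A.g (∑ i, ξ i) Y * A.g (A.proj ξ X) Z) • ∑ i, ξ i) := by
  simp only [covCurv, h.curv_xi_left, h.cov_frameCurv, h.cov_eq, curv_smul_left, h.curv_proj_left]
  module

/-- The second Bianchi identity turns the derivative of the curvature along `ξ i` into derivatives
of the known tensor `R_{ξ_i,Y} Z`. -/
theorem covCurv_xi (X Y Z : L) (i : ι) : A.covCurv (ξ i) X Y Z = -(2 * b) • A.curv X Y Z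
    + (2 * b ^ 3) • ((Fintype.card ι : R) •
          (A.g (A.proj ξ X) Z • A.proj ξ Y - A.g (A.proj ξ Y) Z • A.proj ξ X)
      + A.g (∑ i, ξ i) Z • (A.g (∑ i, ξ i) X • A.proj ξ Y - A.g (∑ i, ξ i) Y • A.proj ξ X)
      + (A.g (∑ i, ξ i) Y * A.g (A.proj ξ X) Z - A.g (∑ i, ξ i) X * A.g (A.proj ξ Y) Z)
        • ∑ i, ξ i) := by
  have bianchi : A.covCurv (ξ i) X Y Z = A.covCurv X (ξ i) Y Z - A.covCurv Y (ξ i) X Z := by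
    have := A.second_bianchi (ξ i) X Y Z
    rw [A.covCurv_swap X Y] at this
    rw [← sub_eq_zero, ← this]
    abel
  rw [bianchi, h.covCurv_xi_left, h.covCurv_xi_left, A.curv_swap Y X]
  simp only [frameCurv]
  module

/-- The trace over `X` of `covCurv_xi`. -/
theorem D_ric_xi (Y Z : L) (i : ι) : A.D (ξ i) (A.ric Y Z) =
    A.ric (A.cov (ξ i) Y) Z + A.ric Y (A.cov (ξ i) Z) - 2 * b * A.ric Y Z
      - 2 * A.trace (A.proj ξ) * b ^ 3 *
        (Fintype.card ι * A.g (A.proj ξ Y) Z + A.g (∑ i, ξ i) Y * A.g (∑ i, ξ i) Z) := by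
  rw [A.D_ric (ξ i) Y Z (-(2 * b) • A.curvEnd Y Z + (2 * b ^ 3) • ((Fintype.card ι : R) •
          ((A.g (A.proj ξ Z)).smulRight (A.proj ξ Y) - A.g (A.proj ξ Y) Z • A.proj ξ)
      + A.g (∑ i, ξ i) Z • ((A.g (∑ i, ξ i)).smulRight (A.proj ξ Y)
        - A.g (∑ i, ξ i) Y • A.proj ξ)
      + (A.g (∑ i, ξ i) Y • A.g (A.proj ξ Z) - A.g (A.proj ξ Y) Z • A.g (∑ i, ξ i)).smulRight
        (∑ i, ξ i)))]
  · simp only [map_add, map_sub, map_smul, trace_smulRight, LinearMap.sub_apply,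
      LinearMap.smul_apply, smul_eq_mul, h.g_sum_proj, h.g_proj_proj, h.g_sum_sum,
      A.g_comm (A.proj ξ Z) (∑ i, ξ i), A.g_proj_comm ξ Z Y, ric_apply]
    ring
  · intro X
    rw [h.covCurv_xi, A.g_proj_comm ξ X, mul_comm (A.g (∑ i, ξ i) X)]
    rfl

theorem ric_xi (Z : L) (i : ι) :
    A.ric (ξ i) Z = -(A.trace (A.proj ξ) * b ^ 2) * A.g (∑ i, ξ i) Z := by
  have curvEnd_eq : A.curvEnd (ξ i) Z = -(b ^ 2) • (A.g (∑ i, ξ i) Z • A.proj ξ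
      - (A.g (A.proj ξ Z)).smulRight (∑ i, ξ i)) := by
    ext X
    rw [curvEnd_apply, curv_swap, h.curv_xi_left, frameCurv, A.g_proj_comm ξ X, ← neg_smul]
    rfl
  rw [ric_apply, curvEnd_eq, map_smul, map_sub, map_smul, trace_smulRight, A.g_comm (A.proj ξ Z),
    h.g_sum_proj]
  simp only [smul_eq_mul]
  ring

section RicciOperator

variable {S : L →ₗ[R] L} (hS : ∀ Y Z, A.g (S Y) Z = A.ric Y Z)
include hS

theorem ricciOp_xi (i : ι) : S (ξ i) = -(A.trace (A.proj ξ) * b ^ 2) • ∑ i, ξ i := by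
  refine A.nondegenerate _ _ fun Z ↦ ?_
  rw [hS, h.ric_xi, map_smul, LinearMap.smul_apply, smul_eq_mul]

theorem cov_ricciOp (X : L) (i : ι) : A.cov (ξ i) (S X) - S (A.cov (ξ i) X) =
    -(2 * b) • S X - (2 * A.trace (A.proj ξ) * b ^ 3) •
      ((Fintype.card ι : R) • A.proj ξ X + A.g (∑ i, ξ i) X • ∑ i, ξ i) := by
  refine A.nondegenerate _ _ fun Z ↦ ?_
  have key := h.D_ric_xi X Z i
  simp only [← hS, A.metric] at key
  simp only [map_sub, map_add, map_smul, LinearMap.sub_apply, LinearMap.add_apply,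
    LinearMap.smul_apply, smul_eq_mul]
  linear_combination key

theorem D_trace_ricciOp (i : ι) : A.D (ξ i) (A.trace S) = -2 * b * (A.trace S
    + Fintype.card ι * A.trace (A.proj ξ) * (A.trace (A.proj ξ) + 1) * b ^ 2) := by
  rw [A.D_trace (ξ i) S (-(2 * b) • S - (2 * A.trace (A.proj ξ) * b ^ 3) •
      ((Fintype.card ι : R) • A.proj ξ + (A.g (∑ i, ξ i)).smulRight (∑ i, ξ i)))]
  · simp only [map_sub, map_add, map_smul, trace_smulRight, h.g_sum_sum, smul_eq_mul]
    ring
  · exact fun X ↦ (h.cov_ricciOp hS X i).symm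

end RicciOperator

end IsKenmotsuFrame

end MetricLieRinehart

namespace WeakKenmotsu

open Filter
open scoped Topology

section SmoothFields

variable {E : Type*} [NormedAddCommGroup E] [NormedSpace ℝ E]
  {H : Type*} [TopologicalSpace H] {I : ModelWithCorners ℝ E H}
  {M : Type*} [TopologicalSpace M] [ChartedSpace H M] [IsManifold I ∞ M]

theorem contMDiff_mvfderiv_apply {f : M → ℝ} {X : Π x : M, TangentSpace I x}
    (hf : CMDiff ∞ f) (hX : CMDiff ∞ (T% X)) : CMDiff ∞ (fun x ↦ d% f x (X x)) :=
  (contMDiff_snd_tangentBundle_modelSpace ℝ 𝓘(ℝ, ℝ)).comp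
    ((hf.contMDiff_tangentMap le_rfl).comp hX)

variable [FiniteDimensional ℝ E]

theorem contMDiff_mlieBracket {X Y : Π x : M, TangentSpace I x}
    (hX : CMDiff ∞ (T% X)) (hY : CMDiff ∞ (T% Y)) : CMDiff ∞ (T% (mlieBracket I X Y)) := by
  refine contMDiff_infty.2 fun m ↦ ?_
  have : IsManifold I ((m + 1 : ℕ∞) + 1) M := .of_le (n := ∞) (by exact_mod_cast le_top)
  have : IsManifold I (minSmoothness ℝ 2) M :=
    .of_le (n := ∞) (by simpa using WithTop.coe_le_coe.2 (le_top : (2 : ℕ∞) ≤ ⊤))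
  exact ContDiff.mlieBracket_vectorField (m := m) (n := m + 1)
    (hX.of_le (by exact_mod_cast le_top)) (hY.of_le (by exact_mod_cast le_top)) (by simp)

theorem leibniz_mlieBracket {X Y Z : Π x : M, TangentSpace I x}
    (hX : CMDiff ∞ (T% X)) (hY : CMDiff ∞ (T% Y)) (hZ : CMDiff ∞ (T% Z)) :
    mlieBracket I X (mlieBracket I Y Z) =
      mlieBracket I (mlieBracket I X Y) Z + mlieBracket I Y (mlieBracket I X Z) := by
  have : IsManifold I (minSmoothness ℝ 3) M :=
    .of_le (n := ∞) (by simpa using WithTop.coe_le_coe.2 (le_top : (3 : ℕ∞) ≤ ⊤))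
  have two_le : minSmoothness ℝ 2 ≤ (∞ : WithTop ℕ∞) := by
    simpa using WithTop.coe_le_coe.2 (le_top : (2 : ℕ∞) ≤ ⊤)
  exact leibniz_identity_mlieBracket (hX.of_le two_le) (hY.of_le two_le) (hZ.of_le two_le)

theorem mlieBracket_smul_right_eq {X Y : Π x : M, TangentSpace I x} {f : M → ℝ}
    (hf : CMDiff ∞ f) (hY : CMDiff ∞ (T% Y)) :
    mlieBracket I X (f • Y) = (fun x ↦ d% f x (X x)) • Y + f • mlieBracket I X Y := by
  ext x
  exact mlieBracket_smul_right (hf.mdifferentiable (by simp) x) (hY.mdifferentiable (by simp) x)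

theorem mlieBracket_add_right_eq {X Y Z : Π x : M, TangentSpace I x}
    (hY : CMDiff ∞ (T% Y)) (hZ : CMDiff ∞ (T% Z)) :
    mlieBracket I X (Y + Z) = mlieBracket I X Y + mlieBracket I X Z := by
  ext x
  exact mlieBracket_add_right (hY.mdifferentiable (by simp) x) (hZ.mdifferentiable (by simp) x)

/-- Compare the Jacobi identities for `X`, `Y`, `f Z` and for `X`, `Y`, `Z`. -/
theorem mvfderiv_mlieBracket_smul {X Y Z : Π x : M, TangentSpace I x} {f : M → ℝ}
    (hX : CMDiff ∞ (T% X)) (hY : CMDiff ∞ (T% Y)) (hZ : CMDiff ∞ (T% Z)) (hf : CMDiff ∞ f)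
    (x : M) : d% f x (mlieBracket I X Y x) • Z x =
      (d% (fun y ↦ d% f y (Y y)) x (X x) - d% (fun y ↦ d% f y (X y)) x (Y x)) • Z x := by
  have hXf := contMDiff_mvfderiv_apply hf hX
  have hYf := contMDiff_mvfderiv_apply hf hY
  have hXZ := contMDiff_mlieBracket hX hZ
  have hYZ := contMDiff_mlieBracket hY hZ
  have jacobi_smul := congrFun (leibniz_mlieBracket hX hY (hf.smul_section hZ)) x
  rw [mlieBracket_smul_right_eq hf hZ, mlieBracket_smul_right_eq hf hZ,
    mlieBracket_smul_right_eq hf hZ,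
    mlieBracket_add_right_eq (hYf.smul_section hZ) (hf.smul_section hYZ),
    mlieBracket_add_right_eq (hXf.smul_section hZ) (hf.smul_section hXZ),
    mlieBracket_smul_right_eq hYf hZ, mlieBracket_smul_right_eq hf hYZ,
    mlieBracket_smul_right_eq hXf hZ, mlieBracket_smul_right_eq hf hXZ,
    leibniz_mlieBracket hX hY hZ] at jacobi_smul
  simp only [Pi.add_apply, Pi.smul_apply'] at jacobi_smul
  rw [← sub_eq_zero] at jacobi_smul ⊢
  rw [← neg_eq_zero, ← jacobi_smul]
  module

variable [T2Space M]

theorem exists_bump {x : M} {U : Set M} (hU : U ∈ 𝓝 x) :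
    ∃ χ : M → ℝ, CMDiff ∞ χ ∧ χ =ᶠ[𝓝 x] 1 ∧ tsupport χ ⊆ U := by
  obtain ⟨φ, -, hφ⟩ := (SmoothBumpFunction.nhds_basis_tsupport (I := I) x).mem_iff.1 hU
  exact ⟨φ, φ.contMDiff, φ.eventuallyEq_one, hφ⟩

theorem exists_contMDiff_eventuallyEq {x : M} {σ : Π x : M, TangentSpace I x}
    (hσ : ∀ᶠ y in 𝓝 x, CMDiffAt ∞ (T% σ) y) :
    ∃ X : Π x : M, TangentSpace I x, CMDiff ∞ (T% X) ∧ ∀ᶠ y in 𝓝 x, X y = σ y := by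
  obtain ⟨U, hU, hUo, hxU⟩ := eventually_nhds_iff.1 hσ
  obtain ⟨χ, hχ, hχ1, hχU⟩ := exists_bump (I := I) (hUo.mem_nhds hxU)
  refine ⟨χ • σ, ContMDiffOn.smul_section_of_tsupport hχ.contMDiffOn hUo hχU
    fun y hy ↦ (hU y hy).contMDiffWithinAt, ?_⟩
  filter_upwards [hχ1] with y hy
  simp [hy]

theorem exists_contMDiff_extend {x : M} (u : TangentSpace I x) :
    ∃ X : Π x : M, TangentSpace I x, CMDiff ∞ (T% X) ∧
      ∀ᶠ y in 𝓝 x, X y = FiberBundle.extend E u y := by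
  obtain ⟨s, hs, h⟩ := FiberBundle.exists_contMDiffOn_extend (k := ∞) I E u
  obtain ⟨U, hU, hUo, hxU⟩ := mem_nhds_iff.1 hs
  refine exists_contMDiff_eventuallyEq ?_
  filter_upwards [hUo.mem_nhds hxU] with y hy
  exact h.contMDiffAt (mem_of_superset (hUo.mem_nhds hy) hU)

theorem mvfderiv_mlieBracket {X Y : Π x : M, TangentSpace I x} {f : M → ℝ}
    (hX : CMDiff ∞ (T% X)) (hY : CMDiff ∞ (T% Y)) (hf : CMDiff ∞ f) (x : M) :
    d% f x (mlieBracket I X Y x) =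
      d% (fun y ↦ d% f y (Y y)) x (X x) - d% (fun y ↦ d% f y (X y)) x (Y x) := by
  by_cases hx : ∃ u : TangentSpace I x, u ≠ 0
  · obtain ⟨u, hu⟩ := hx
    obtain ⟨Z, hZ, hZu⟩ := exists_contMDiff_extend u
    have hZx : Z x ≠ 0 := by rwa [show Z x = u by simpa using hZu.self_of_nhds]
    exact smul_left_injective ℝ hZx (mvfderiv_mlieBracket_smul hX hY hZ hf x)
  · push Not at hx
    simp [hx]

end SmoothFields

section Frames

variable {E : Type*} [NormedAddCommGroup E] [NormedSpace ℝ E]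
  {H : Type*} [TopologicalSpace H] {I : ModelWithCorners ℝ E H}
  {M : Type*} [TopologicalSpace M] [ChartedSpace H M] [IsManifold I ∞ M]
  [RiemannianBundle (fun x : M ↦ TangentSpace I x)]
  [IsContMDiffRiemannianBundle I ∞ E (fun x : M ↦ TangentSpace I x)]

theorem contMDiffAt_inner {X Y : Π x : M, TangentSpace I x} {x : M}
    (hX : CMDiffAt ∞ (T% X) x) (hY : CMDiffAt ∞ (T% Y) x) :
    CMDiffAt ∞ (fun y ↦ (inner ℝ (X y) (Y y) : ℝ)) x :=
  ContMDiffAt.inner_bundle (F := E) (E := fun x : M ↦ TangentSpace I x) hX hY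

theorem contMDiffAt_norm_inv_smul {X : Π x : M, TangentSpace I x} {x : M}
    (hX : CMDiffAt ∞ (T% X) x) (hx : X x ≠ 0) :
    CMDiffAt ∞ (T% (fun y ↦ ‖X y‖⁻¹ • X y)) x := by
  have hpos : (inner ℝ (X x) (X x) : ℝ) ≠ 0 := inner_self_ne_zero.2 hx
  simp only [norm_eq_sqrt_real_inner]
  refine ContMDiffAt.smul_section (ContMDiffAt.inv₀ ?_ ?_) hX
  · exact (Real.contDiffAt_sqrt hpos).contMDiffAt.comp x (contMDiffAt_inner hX hX)
  · exact (Real.sqrt_ne_zero real_inner_self_nonneg).2 hpos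

theorem contMDiffAt_gramSchmidt {m : ℕ} {e : Fin m → Π x : M, TangentSpace I x} {x : M}
    (he : ∀ i, CMDiffAt ∞ (T% (e i)) x) (hli : LinearIndependent ℝ (fun i ↦ e i x)) (i : Fin m) :
    CMDiffAt ∞ (T% (fun y ↦ InnerProductSpace.gramSchmidt ℝ (fun j ↦ e j y) i)) x := by
  induction i using WellFoundedLT.induction with
  | _ i ih =>
    let G (j : Fin m) (y : M) := InnerProductSpace.gramSchmidt ℝ (fun j ↦ e j y) j
    have recursion (y : M) : G i y = (e i - fun y ↦ ∑ k ∈ Finset.Iio i,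
        (fun y ↦ (inner ℝ (G k y) (e i y) : ℝ) / inner ℝ (G k y) (G k y)) y • G k y) y := by
      rw [Pi.sub_apply, eq_sub_iff_add_eq]
      simpa [real_inner_self_eq_norm_sq] using
        (InnerProductSpace.gramSchmidt_def'' ℝ (fun j ↦ e j y) i).symm
    simp_rw [G] at recursion
    simp_rw [recursion]
    refine (he i).sub_section (ContMDiffAt.sum_section fun k hk ↦ ?_)
    have hG := ih k (Finset.mem_Iio.1 hk)
    exact ((contMDiffAt_inner hG (he i)).div₀ (contMDiffAt_inner hG hG)
      (inner_self_ne_zero.2 (InnerProductSpace.gramSchmidt_ne_zero k hli))).smul_section hG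

theorem contMDiffAt_gramSchmidtNormed {m : ℕ} {e : Fin m → Π x : M, TangentSpace I x} {x : M}
    (he : ∀ i, CMDiffAt ∞ (T% (e i)) x) (hli : LinearIndependent ℝ (fun i ↦ e i x)) (i : Fin m) :
    CMDiffAt ∞ (T% (fun y ↦ InnerProductSpace.gramSchmidtNormed ℝ (fun j ↦ e j y) i)) x :=
  contMDiffAt_norm_inv_smul (contMDiffAt_gramSchmidt he hli i)
    (InnerProductSpace.gramSchmidt_ne_zero i hli)

variable [FiniteDimensional ℝ E] [T2Space M]

variable (I) in
theorem exists_orthonormal_frame (x : M) :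
    ∃ e : Fin (finrank ℝ E) → Π x : M, TangentSpace I x, (∀ a, CMDiff ∞ (T% (e a))) ∧
      ∀ᶠ y in 𝓝 x, Orthonormal ℝ (fun a ↦ e a y) := by
  let t := trivializationAt E (fun x : M ↦ TangentSpace I x) x
  let b := finBasis ℝ E
  have frame_t := t.isLocalFrameOn_localFrame_baseSet I ∞ b
  have near_x : ∀ᶠ y in 𝓝 x, y ∈ t.baseSet :=
    t.open_baseSet.mem_nhds (FiberBundle.mem_baseSet_trivializationAt' x)
  have smooth (a) : ∀ᶠ y in 𝓝 x, CMDiffAt ∞ (T% (fun y ↦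
      InnerProductSpace.gramSchmidtNormed ℝ (fun j ↦ t.localFrame b j y) a)) y := by
    filter_upwards [near_x] with y hy
    exact contMDiffAt_gramSchmidtNormed (fun i ↦ frame_t.contMDiffAt t.open_baseSet hy i)
      (frame_t.linearIndependent hy) a
  choose e he he_eq using fun a ↦ exists_contMDiff_eventuallyEq (smooth a)
  refine ⟨e, he, ?_⟩
  filter_upwards [near_x, eventually_all.2 he_eq] with y hy h
  rw [funext h]
  exact InnerProductSpace.gramSchmidtNormed_orthonormal (frame_t.linearIndependent hy)

end Frames

section SmoothModule

variable {E : Type*} [NormedAddCommGroup E] [NormedSpace ℝ E]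
  {H : Type*} [TopologicalSpace H] {I : ModelWithCorners ℝ E H}
  {M : Type*} [TopologicalSpace M] [ChartedSpace H M]

variable (I M) in
/-- The ring of smooth real functions. -/
abbrev SmoothFun := C^∞⟮I, M; 𝓘(ℝ, ℝ), ℝ⟯

instance : IsAddTorsionFree (SmoothFun I M) :=
  Function.Injective.isAddTorsionFree
    (ContMDiffMap.coeFnAddMonoidHom : SmoothFun I M →+ (M → ℝ)) DFunLike.coe_injective

variable (I) in
/-- The value of a smooth function at `x`. -/
noncomputable abbrev evalHom (x : M) : SmoothFun I M →+* ℝ := ContMDiffMap.evalRingHom x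

theorem evalHom_const (x : M) (c : ℝ) : evalHom I x (ContMDiffMap.const c) = c := rfl

variable [IsManifold I ∞ M]

variable (I M) in
/-- The space of smooth vector fields, a module over the smooth functions. -/
abbrev SmoothField := Cₛ^∞⟮I; E, fun x : M ↦ TangentSpace I x⟯

noncomputable instance : SMul (SmoothFun I M) (SmoothField I M) :=
  ⟨fun f X ↦ ⟨(f : M → ℝ) • (⇑X : Π x : M, TangentSpace I x), f.contMDiff.smul_section X.contMDiff⟩⟩

noncomputable instance : Module (SmoothFun I M) (SmoothField I M) where
  one_smul X := by ext x; exact one_smul ℝ (X x)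
  mul_smul f g X := by ext x; exact mul_smul (f x) (g x) (X x)
  smul_zero f := by ext x; exact smul_zero (f x)
  smul_add f X Y := by ext x; exact smul_add (f x) (X x) (Y x)
  add_smul f g X := by ext x; exact add_smul (f x) (g x) (X x)
  zero_smul X := by ext x; exact zero_smul ℝ (X x)

/-- The value of a smooth field at `x`, as a map semilinear over `evalHom I x`. -/
noncomputable def evalField (x : M) : SmoothField I M →ₛₗ[evalHom I x] TangentSpace I x where
  toFun X := X x
  map_add' _ _ := rfl
  map_smul' _ _ := rfl

@[simp] theorem evalField_apply (x : M) (X : SmoothField I M) : evalField x X = X x := rfl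

theorem smoothField_sum_apply {ι : Type*} (t : Finset ι) (X : ι → SmoothField I M) (x : M) :
    (∑ a ∈ t, X a) x = ∑ a ∈ t, X a x :=
  map_sum (evalField x) X t

variable [FiniteDimensional ℝ E] [T2Space M]

theorem exists_smoothField_eventuallyEq_extend {x : M} (u : TangentSpace I x) :
    ∃ X : SmoothField I M, X x = u ∧ ∀ᶠ y in 𝓝 x, FiberBundle.extend E u y = X y := by
  obtain ⟨X, hX, hXu⟩ := exists_contMDiff_extend u
  exact ⟨⟨X, hX⟩, by simpa using hXu.self_of_nhds, hXu.mono fun _ h ↦ h.symm⟩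

theorem exists_smoothField_apply_eq {x : M} (u : TangentSpace I x) :
    ∃ X : SmoothField I M, X x = u :=
  let ⟨X, hX, _⟩ := exists_smoothField_eventuallyEq_extend u
  ⟨X, hX⟩

theorem smoothField_ext_inner [RiemannianBundle (fun x : M ↦ TangentSpace I x)]
    {X Y : SmoothField I M} {x : M}
    (h : ∀ Z : SmoothField I M, inner ℝ (X x) (Z x) = inner ℝ (Y x) (Z x)) : X x = Y x := by
  refine ext_inner_right ℝ fun w ↦ ?_
  obtain ⟨Z, rfl⟩ := exists_smoothField_apply_eq w
  exact h Z

end SmoothModule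

section Tensoriality

variable {E : Type*} [NormedAddCommGroup E] [NormedSpace ℝ E] [FiniteDimensional ℝ E]
  {H : Type*} [TopologicalSpace H] {I : ModelWithCorners ℝ E H}
  {M : Type*} [TopologicalSpace M] [ChartedSpace H M] [IsManifold I ∞ M]
  [T2Space M] [RiemannianBundle (fun x : M ↦ TangentSpace I x)]
  [IsContMDiffRiemannianBundle I ∞ E (fun x : M ↦ TangentSpace I x)]

variable (I) in
theorem exists_orthonormalBasis_smoothField (x : M) :
    ∃ e : Fin (finrank ℝ E) → SmoothField I M, ∀ᶠ y in 𝓝 x,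
      ∃ b : OrthonormalBasis (Fin (finrank ℝ E)) ℝ (TangentSpace I y), ∀ a, b a = e a y := by
  obtain ⟨e, he, orthonormal_e⟩ := exists_orthonormal_frame I x
  refine ⟨fun a ↦ ⟨e a, he a⟩, orthonormal_e.mono fun y hy ↦ ?_⟩
  have hcard : Fintype.card (Fin (finrank ℝ E)) = finrank ℝ (TangentSpace I y) :=
    Fintype.card_fin _
  exact ⟨OrthonormalBasis.mk hy (hy.linearIndependent.span_eq_top_of_card_eq_finrank' hcard).ge,
    fun a ↦ congrFun (OrthonormalBasis.coe_mk _ _) a⟩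

variable {V : Type*} [AddCommGroup V] [Module ℝ V] {x : M}
  (φ : SmoothField I M →ₛₗ[evalHom I x] V)

/-- With a bump function `χ` at `x` supported where a frame `e` is orthonormal,
`χ X = ∑ χ g(e_a, X) e_a` globally. -/
theorem map_eq_zero_of_apply_eq_zero {X : SmoothField I M} (hX : X x = 0) : φ X = 0 := by
  obtain ⟨e, frame_e⟩ := exists_orthonormalBasis_smoothField I x
  obtain ⟨χ, hχ, χ_eq_one, χ_support⟩ := exists_bump (I := I) frame_e
  let χ' : SmoothFun I M := ⟨χ, hχ⟩
  let coeff (a) : SmoothFun I M :=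
    ⟨fun y ↦ χ y * inner ℝ (e a y) (X y), hχ.mul fun y ↦
      contMDiffAt_inner (e a).contMDiff.contMDiffAt X.contMDiff.contMDiffAt⟩
  have expansion : χ' • X = ∑ a, coeff a • e a := by
    ext y
    rw [smoothField_sum_apply]
    change χ y • X y = ∑ a, (χ y * inner ℝ (e a y) (X y)) • e a y
    by_cases hy : χ y = 0
    · simp [hy]
    · obtain ⟨b, hb⟩ := χ_support (subset_tsupport _ hy)
      simp only [mul_smul, ← Finset.smul_sum, ← hb, b.sum_repr']
  have coeff_apply (a) : evalHom I x (coeff a) = 0 := by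
    change χ x * inner ℝ (e a x) (X x) = 0
    rw [hX, inner_zero_right, mul_zero]
  have χ_apply : evalHom I x χ' = 1 := χ_eq_one.self_of_nhds
  simpa only [map_smulₛₗ, map_sum, coeff_apply, χ_apply, one_smul, zero_smul,
    Finset.sum_const_zero] using congr(φ $expansion)

theorem map_eq_of_apply_eq {X Y : SmoothField I M} (h : X x = Y x) : φ X = φ Y := by
  rw [← sub_eq_zero, ← map_sub]
  exact map_eq_zero_of_apply_eq_zero φ (sub_eq_zero.2 h)

/-- The linear map on `T_x M` induced by a map of smooth fields that is linear over the smooth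
functions acting through their values at `x`. -/
noncomputable def tensorAt : TangentSpace I x →ₗ[ℝ] V where
  toFun u := φ (exists_smoothField_apply_eq u).choose
  map_add' u v := by
    rw [← map_add]
    refine map_eq_of_apply_eq φ ?_
    rw [ContMDiffSection.coe_add, Pi.add_apply]
    simp only [(exists_smoothField_apply_eq _).choose_spec]
  map_smul' c u := by
    refine Eq.trans (map_eq_of_apply_eq φ ?_)
      (map_smulₛₗ φ (ContMDiffMap.const c : SmoothFun I M) (exists_smoothField_apply_eq u).choose)
    change _ = c • (exists_smoothField_apply_eq u).choose x
    simp only [(exists_smoothField_apply_eq _).choose_spec]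

@[simp] theorem tensorAt_apply (X : SmoothField I M) : tensorAt φ (X x) = φ X :=
  map_eq_of_apply_eq φ (exists_smoothField_apply_eq (X x)).choose_spec

/-- The endomorphism of `T_x M` induced by an endomorphism of the module of smooth fields. -/
noncomputable def endAt (T : SmoothField I M →ₗ[SmoothFun I M] SmoothField I M) (x : M) :
    TangentSpace I x →ₗ[ℝ] TangentSpace I x :=
  tensorAt ((evalField x).comp T)

@[simp] theorem endAt_apply (T : SmoothField I M →ₗ[SmoothFun I M] SmoothField I M)
    (X : SmoothField I M) : endAt T x (X x) = T X x :=
  tensorAt_apply _ X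

/-- The covector at `x` induced by a linear form on the module of smooth fields. -/
noncomputable def formAt (θ : SmoothField I M →ₗ[SmoothFun I M] SmoothFun I M) (x : M) :
    TangentSpace I x →ₗ[ℝ] ℝ :=
  tensorAt ((evalHom I x).toSemilinearMap.comp θ)

@[simp] theorem formAt_apply (θ : SmoothField I M →ₗ[SmoothFun I M] SmoothFun I M)
    (X : SmoothField I M) : formAt θ x (X x) = θ X x :=
  tensorAt_apply _ X

end Tensoriality

section LeviCivita

variable {E : Type*} [NormedAddCommGroup E] [NormedSpace ℝ E]
  {H : Type*} [TopologicalSpace H] {I : ModelWithCorners ℝ E H}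
  {M : Type*} [TopologicalSpace M] [ChartedSpace H M] [IsManifold I ∞ M]

/-- The action of a smooth field on the smooth functions. -/
noncomputable def derivation (X : SmoothField I M) :
    Derivation ℤ (SmoothFun I M) (SmoothFun I M) :=
  .mk' (AddMonoidHom.toIntLinearMap
    { toFun r := ⟨fun x ↦ d% r x (X x), contMDiff_mvfderiv_apply r.contMDiff X.contMDiff⟩
      map_add' r t := by
        ext x
        exact congr($(mvfderiv_add r.mdifferentiableAt t.mdifferentiableAt) (X x))
      map_zero' := by
        ext x
        exact congr($(mvfderiv_const (I := I) (0 : ℝ)) (X x)) }) fun r t ↦ by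
    ext x
    exact congr($(mvfderiv_mul r.mdifferentiableAt t.mdifferentiableAt) (X x))

theorem derivation_apply (X : SmoothField I M) (r : SmoothFun I M) (x : M) :
    derivation X r x = d% r x (X x) := rfl

theorem derivation_congr {r t : SmoothFun I M} {x : M} (h : r =ᶠ[𝓝 x] t) (X : SmoothField I M) :
    derivation X r x = derivation X t x := by
  rw [derivation_apply, derivation_apply, mvfderiv, mvfderiv, h.mfderiv_eq]
  rfl

theorem derivation_const (X : SmoothField I M) (c : ℝ) :
    derivation X (ContMDiffMap.const c) = 0 := by
  ext x
  exact congr($(mvfderiv_const (I := I) (M := M) c) (X x))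

variable [RiemannianBundle (fun x : M ↦ TangentSpace I x)]
  [IsContMDiffRiemannianBundle I ∞ E (fun x : M ↦ TangentSpace I x)]

variable (I M) in
/-- The Riemannian metric as a bilinear form on the module of smooth fields. -/
noncomputable def metricForm :
    SmoothField I M →ₗ[SmoothFun I M] SmoothField I M →ₗ[SmoothFun I M] SmoothFun I M :=
  LinearMap.mk₂ _ (fun X Y ↦ ⟨fun x ↦ inner ℝ (X x) (Y x), fun _ ↦
      contMDiffAt_inner X.contMDiff.contMDiffAt Y.contMDiff.contMDiffAt⟩)
    (fun X Y Z ↦ by ext x; exact inner_add_left (X x) (Y x) (Z x))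
    (fun r X Y ↦ by ext x; exact real_inner_smul_left (X x) (Y x) (r x))
    (fun X Y Z ↦ by ext x; exact inner_add_right (X x) (Y x) (Z x))
    (fun r X Y ↦ by ext x; exact real_inner_smul_right (X x) (Y x) (r x))

@[simp] theorem metricForm_apply (X Y : SmoothField I M) (x : M) :
    metricForm I M X Y x = inner ℝ (X x) (Y x) := rfl

variable [FiniteDimensional ℝ E]

theorem contMDiff_koszul (X Y Z : SmoothField I M) : CMDiff ∞ (koszul X Y Z) := by
  have derivative (X Y Z : SmoothField I M) := (derivation X (metricForm I M Y Z)).contMDiff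
  have bracket (X Y Z : SmoothField I M) :=
    (metricForm I M ⟨mlieBracket I X Y, contMDiff_mlieBracket X.contMDiff Y.contMDiff⟩ Z).contMDiff
  exact contMDiff_const.mul ((((((derivative X Y Z).add (derivative Y Z X)).sub
    (derivative Z X Y)).add (bracket X Y Z)).sub (bracket Y Z X)).add (bracket Z X Y))

variable [T2Space M]

theorem contMDiff_of_inner {V : Π x : M, TangentSpace I x}
    (h : ∀ Z : SmoothField I M, CMDiff ∞ fun x ↦ inner ℝ (V x) (Z x)) : CMDiff ∞ (T% V) := by
  intro x
  obtain ⟨e, frame_e⟩ := exists_orthonormalBasis_smoothField I x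
  have expansion : CMDiffAt ∞ (T% fun y ↦ ∑ a, inner ℝ (V y) (e a y) • e a y) x :=
    ContMDiffAt.sum_section fun a _ ↦ (h (e a) x).smul_section (e a).contMDiff.contMDiffAt
  refine expansion.congr_of_eventuallyEq (frame_e.mono fun y ⟨b, hb⟩ ↦ ?_)
  simp only [← hb, real_inner_comm (b _), b.sum_repr']

/-- The covariant derivative of a smooth field along a smooth field. -/
noncomputable def covField (X Y : SmoothField I M) : SmoothField I M :=
  ⟨fun x ↦ leviCivita Y x (X x), contMDiff_of_inner fun Z ↦ by
    refine (contMDiff_koszul X Y Z).congr fun x ↦ ?_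
    exact inner_nabla_eq_koszul X.mdifferentiableAt Y.mdifferentiableAt
      Z.mdifferentiableAt⟩

theorem covField_apply (X Y : SmoothField I M) (x : M) :
    covField X Y x = leviCivita Y x (X x) := rfl

theorem metricForm_covField (X Y Z : SmoothField I M) :
    derivation X (metricForm I M Y Z) =
      metricForm I M (covField X Y) Z + metricForm I M Y (covField X Z) := by
  ext x
  exact leviCivita_metric X.mdifferentiableAt Y.mdifferentiableAt Z.mdifferentiableAt

/-- The Lie bracket of smooth fields. -/
noncomputable def bracketField (X Y : SmoothField I M) : SmoothField I M :=
  ⟨mlieBracket I X Y, contMDiff_mlieBracket X.contMDiff Y.contMDiff⟩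

theorem covField_sub (X Y : SmoothField I M) :
    covField X Y - covField Y X = bracketField X Y := by
  ext x
  exact leviCivita_torsion X.mdifferentiableAt Y.mdifferentiableAt

variable (I M) in
/-- The Levi-Civita connection as an operation on smooth fields, linear over the smooth functions
in the direction. -/
noncomputable def connection :
    SmoothField I M →ₗ[SmoothFun I M] SmoothField I M →+ SmoothField I M where
  toFun X :=
    { toFun Y := covField X Y
      map_zero' := by
        ext x
        exact congr($(leviCivita.zero) x (X x))
      map_add' Y Z := by
        ext x
        exact congr($(leviCivita.isCovariantDerivativeOn.add Y.mdifferentiableAt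
          Z.mdifferentiableAt) (X x)) }
  map_add' X Y := by
    ext Z x
    exact map_add (leviCivita Z x) (X x) (Y x)
  map_smul' r X := by
    ext Z x
    exact map_smul (leviCivita Z x) (r x) (X x)

theorem trace_endAt {ι : Type*} [Fintype ι] {x : M}
    {b : OrthonormalBasis ι ℝ (TangentSpace I x)} {e : ι → SmoothField I M}
    (hb : ∀ a, b a = e a x) (T : SmoothField I M →ₗ[SmoothFun I M] SmoothField I M) :
    LinearMap.trace ℝ _ (endAt T x) = ∑ a, metricForm I M (e a) (T (e a)) x := by
  simp only [LinearMap.trace_eq_sum_inner _ b, hb, endAt_apply, metricForm_apply]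

theorem trace_endAt_eventuallyEq {ι : Type*} [Fintype ι] {x : M} {e : ι → SmoothField I M}
    (he : ∀ᶠ y in 𝓝 x, ∃ b : OrthonormalBasis ι ℝ (TangentSpace I y), ∀ a, b a = e a y)
    (T : SmoothField I M →ₗ[SmoothFun I M] SmoothField I M) :
    (fun y ↦ LinearMap.trace ℝ _ (endAt T y)) =ᶠ[𝓝 x]
      ⇑(∑ a, metricForm I M (e a) (T (e a))) := by
  filter_upwards [he] with y ⟨b, hb⟩
  rw [trace_endAt hb]
  exact (map_sum (evalHom I y) (fun a ↦ metricForm I M (e a) (T (e a))) _).symm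

variable (I M) in
/-- The trace of an endomorphism of the module of smooth fields, taken in each tangent space. -/
noncomputable def traceField :
    (SmoothField I M →ₗ[SmoothFun I M] SmoothField I M) →ₗ[SmoothFun I M] SmoothFun I M where
  toFun T := ⟨fun x ↦ LinearMap.trace ℝ _ (endAt T x), fun x ↦
    have ⟨_, frame_e⟩ := exists_orthonormalBasis_smoothField I x
    (ContMDiffMap.contMDiff _ x).congr_of_eventuallyEq (trace_endAt_eventuallyEq frame_e T)⟩
  map_add' S T := by
    ext x
    refine (congrArg (LinearMap.trace ℝ _) (LinearMap.ext fun u ↦ ?_)).trans (map_add _ _ _)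
    obtain ⟨X, rfl⟩ := exists_smoothField_apply_eq u
    simp
  map_smul' r T := by
    ext x
    refine (congrArg (LinearMap.trace ℝ _) (LinearMap.ext fun u ↦ ?_)).trans (map_smul _ (r x) _)
    obtain ⟨X, rfl⟩ := exists_smoothField_apply_eq u
    simp only [endAt_apply, LinearMap.smul_apply]
    rfl

theorem traceField_apply (T : SmoothField I M →ₗ[SmoothFun I M] SmoothField I M) (x : M) :
    traceField I M T x = LinearMap.trace ℝ _ (endAt T x) := rfl

theorem sum_inner_add_inner_eq_zero {V ι : Type*} [NormedAddCommGroup V] [InnerProductSpace ℝ V]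
    [Fintype ι] (b : OrthonormalBasis ι ℝ V) (T : V →ₗ[ℝ] V) {k : ι → V}
    (skew : ∀ a c, inner ℝ (k a) (b c) + inner ℝ (b a) (k c) = 0) :
    ∑ a, (inner ℝ (k a) (T (b a)) + inner ℝ (b a) (T (k a))) = 0 := by
  have inner_k (a) (v : V) : inner ℝ (k a) v = -∑ c, inner ℝ (b a) (k c) * inner ℝ (b c) v := by
    rw [← b.sum_inner_mul_inner, ← Finset.sum_neg_distrib]
    exact Finset.sum_congr rfl fun c _ ↦ by rw [eq_neg_of_add_eq_zero_left (skew a c), neg_mul]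
  have T_k (a) : inner ℝ (b a) (T (k a)) = ∑ c, inner ℝ (b c) (k a) * inner ℝ (b a) (T (b c)) := by
    conv_lhs => rw [← b.sum_repr' (k a)]
    simp only [map_sum, map_smul, inner_sum, real_inner_smul_right]
  simp only [inner_k, T_k, Finset.sum_add_distrib, Finset.sum_neg_distrib]
  rw [Finset.sum_comm, neg_add_cancel]

theorem derivation_traceField (X : SmoothField I M)
    {T T' : SmoothField I M →ₗ[SmoothFun I M] SmoothField I M}
    (hT : ∀ Y, T' Y = covField X (T Y) - T (covField X Y)) :
    derivation X (traceField I M T) = traceField I M T' := by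
  ext x
  obtain ⟨e, frame_e⟩ := exists_orthonormalBasis_smoothField I x
  obtain ⟨b, hb⟩ := frame_e.self_of_nhds
  have skew (a c) :
      inner ℝ (covField X (e a) x) (b c) + inner ℝ (b a) (covField X (e c) x) = 0 := by
    have gram : metricForm I M (e a) (e c) =ᶠ[𝓝 x]
        (ContMDiffMap.const (if a = c then 1 else 0) : SmoothFun I M) := by
      filter_upwards [frame_e] with y ⟨b', hb'⟩
      rw [metricForm_apply, ← hb', ← hb', orthonormal_iff_ite.1 b'.orthonormal]
      rfl
    have key := derivation_congr gram X
    rw [derivation_const, metricForm_covField] at key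
    rw [hb, hb]
    exact key
  have product_rule (a) : derivation X (metricForm I M (e a) (T (e a))) =
      metricForm I M (e a) (T' (e a)) + (metricForm I M (covField X (e a)) (T (e a)) +
        metricForm I M (e a) (T (covField X (e a)))) := by
    rw [metricForm_covField, hT, map_sub]
    abel
  calc derivation X (traceField I M T) x
    _ = evalHom I x (derivation X (∑ a, metricForm I M (e a) (T (e a)))) :=
      derivation_congr (trace_endAt_eventuallyEq frame_e T) X
    _ = ∑ a, metricForm I M (e a) (T' (e a)) x + ∑ a, (inner ℝ (covField X (e a) x)
          (endAt T x (b a)) + inner ℝ (b a) (endAt T x (covField X (e a) x))) := by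
      simp only [map_sum, product_rule, map_add, Finset.sum_add_distrib, hb, endAt_apply]
      rfl
    _ = traceField I M T' x := by
      rw [sum_inner_add_inner_eq_zero b _ skew, add_zero, traceField_apply, trace_endAt hb]

variable (I M) in
/-- The smooth fields of a Riemannian manifold over the ring of smooth functions. -/
noncomputable def leviCivitaAlgebra : MetricLieRinehart (SmoothFun I M) (SmoothField I M) where
  D :=
    { toFun := derivation
      map_add' X Y := by
        ext r x
        exact map_add (d% r x) (X x) (Y x)
      map_smul' r X := by
        ext t x
        exact map_smul (d% t x) (r x) (X x) }
  g := metricForm I M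
  cov := connection I M
  trace := traceField I M
  g_comm X Y := by
    ext x
    exact real_inner_comm (Y x) (X x)
  nondegenerate X Y h := by
    ext x
    exact smoothField_ext_inner fun Z ↦ congr($(h Z) x)
  leibniz X r Y := by
    ext x
    exact congr($(leviCivita.isCovariantDerivativeOn.leibniz Y.mdifferentiableAt
      r.mdifferentiableAt) (X x))
  metric := metricForm_covField
  D_bracket X Y r := by
    ext x
    refine Eq.trans ?_ (mvfderiv_mlieBracket X.contMDiff Y.contMDiff r.contMDiff x)
    exact congr(d% r x $(leviCivita_torsion X.mdifferentiableAt Y.mdifferentiableAt))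
  jacobi X Y Z := by
    change covField X (covField Y Z - covField Z Y) - covField (covField Y Z - covField Z Y) X =
      covField (covField X Y - covField Y X) Z - covField Z (covField X Y - covField Y X)
      + (covField Y (covField X Z - covField Z X) - covField (covField X Z - covField Z X) Y)
    simp only [covField_sub]
    ext x
    exact congrFun (leibniz_mlieBracket X.contMDiff Y.contMDiff Z.contMDiff) x
  trace_smulRight θ X := by
    ext x
    refine Eq.trans ?_ ((LinearMap.trace_smulRight (formAt θ x) (X x)).trans (formAt_apply θ X))
    refine congrArg (LinearMap.trace ℝ _) (LinearMap.ext fun u ↦ ?_)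
    obtain ⟨Y, rfl⟩ := exists_smoothField_apply_eq u
    simp only [endAt_apply, LinearMap.smulRight_apply, formAt_apply]
    rfl
  D_trace X T T' hT := derivation_traceField X hT

end LeviCivita

section Ricci

variable {E : Type*} [NormedAddCommGroup E] [NormedSpace ℝ E] [FiniteDimensional ℝ E]
  {H : Type*} [TopologicalSpace H] {I : ModelWithCorners ℝ E H}
  {M : Type*} [TopologicalSpace M] [ChartedSpace H M] [IsManifold I ∞ M]
  [RiemannianBundle (fun x : M ↦ TangentSpace I x)]
  [IsContMDiffRiemannianBundle I ∞ E (fun x : M ↦ TangentSpace I x)]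

theorem leviCivita_congr {x : M} {X : Π x : M, TangentSpace I x} {X' : SmoothField I M}
    (h : ∀ᶠ y in 𝓝 x, X y = X' y) : leviCivita X x = leviCivita X' x := by
  have hX : MDiffAt (T% X) x := by
    refine X'.mdifferentiableAt.congr_of_eventuallyEq ?_
    filter_upwards [h] with y hy
    rw [hy]
  exact leviCivita.isCovariantDerivativeOnUniv.congr_of_eventuallyEq hX X'.mdifferentiableAt
    univ_mem h

variable [T2Space M]

theorem curvature_congr {x : M} {X Y Z : Π x : M, TangentSpace I x} {X' Y' Z' : SmoothField I M}
    (hX : ∀ᶠ y in 𝓝 x, X y = X' y) (hY : ∀ᶠ y in 𝓝 x, Y y = Y' y)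
    (hZ : ∀ᶠ y in 𝓝 x, Z y = Z' y) :
    curvature X Y Z x = (leviCivitaAlgebra I M).curv X' Y' Z' x := by
  have cov_Z {V : Π x : M, TangentSpace I x} {V' : SmoothField I M}
      (hV : ∀ᶠ y in 𝓝 x, V y = V' y) :
      ∀ᶠ y in 𝓝 x, leviCivita Z y (V y) = covField V' Z' y := by
    filter_upwards [hV, hZ.eventually_nhds] with y hy hz
    rw [leviCivita_congr hz, hy, covField_apply]
  have bracket_eq : mlieBracket I X Y x = (covField X' Y' - covField Y' X') x := by
    rw [covField_sub]
    exact EventuallyEq.mlieBracket_vectorField_eq hX hY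
  rw [curvature, leviCivita_congr (cov_Z hY), leviCivita_congr (cov_Z hX), leviCivita_congr hZ,
    bracket_eq, hX.self_of_nhds, hY.self_of_nhds]
  rfl

theorem curvature_apply (X Y Z : SmoothField I M) (x : M) :
    curvature X Y Z x = (leviCivitaAlgebra I M).curv X Y Z x :=
  curvature_congr (.of_forall fun _ ↦ rfl) (.of_forall fun _ ↦ rfl) (.of_forall fun _ ↦ rfl)

theorem curv_apply_congr {X X' Y Y' Z Z' : SmoothField I M} {x : M}
    (hX : X x = X' x) (hY : Y x = Y' x) (hZ : Z x = Z' x) :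
    (leviCivitaAlgebra I M).curv X Y Z x = (leviCivitaAlgebra I M).curv X' Y' Z' x := by
  have first {X X' : SmoothField I M} (hX : X x = X' x) (Y Z : SmoothField I M) :
      (leviCivitaAlgebra I M).curv X Y Z x = (leviCivitaAlgebra I M).curv X' Y Z x :=
    map_eq_of_apply_eq ((evalField x).comp ((leviCivitaAlgebra I M).curvEnd Y Z)) hX
  calc (leviCivitaAlgebra I M).curv X Y Z x
    _ = (leviCivitaAlgebra I M).curv X' Y Z x := first hX Y Z
    _ = (leviCivitaAlgebra I M).curv X' Y' Z x := by
      rw [(leviCivitaAlgebra I M).curv_swap X' Y, (leviCivitaAlgebra I M).curv_swap X' Y']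
      exact congr(-$(first hY X' Z))
    _ = (leviCivitaAlgebra I M).curv X' Y' Z' x :=
      map_eq_of_apply_eq ((evalField x).comp ((leviCivitaAlgebra I M).curv X' Y')) hZ

theorem curvatureAt_apply (X Y Z : SmoothField I M) (x : M) :
    curvatureAt x (X x) (Y x) (Z x) = (leviCivitaAlgebra I M).curv X Y Z x := by
  obtain ⟨X', hX', extend_X⟩ := exists_smoothField_eventuallyEq_extend (X x)
  obtain ⟨Y', hY', extend_Y⟩ := exists_smoothField_eventuallyEq_extend (Y x)
  obtain ⟨Z', hZ', extend_Z⟩ := exists_smoothField_eventuallyEq_extend (Z x)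
  exact (curvature_congr extend_X extend_Y extend_Z).trans (curv_apply_congr hX' hY' hZ')

theorem ricci_apply (Y Z : SmoothField I M) (x : M) :
    ricci x (Y x) (Z x) = (leviCivitaAlgebra I M).ric Y Z x := by
  have endAt_curvEnd (u) : endAt ((leviCivitaAlgebra I M).curvEnd Y Z) x u =
      curvatureAt x u (Y x) (Z x) := by
    obtain ⟨X, rfl⟩ := exists_smoothField_apply_eq u
    rw [endAt_apply, MetricLieRinehart.curvEnd_apply, curvatureAt_apply]
  refine Eq.trans ?_ (LinearMap.trace_eq_sum_inner _ (frame x)).symm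
  exact Finset.sum_congr rfl fun a _ ↦ by rw [endAt_curvEnd, real_inner_comm]

theorem inner_ricciOp (Y Z : SmoothField I M) (x : M) :
    inner ℝ (ricciOp x (Y x)) (Z x) = (leviCivitaAlgebra I M).ric Y Z x := by
  have ricci_eq_formAt (v) : ricci x (Y x) v = formAt ((leviCivitaAlgebra I M).ric Y) x v := by
    obtain ⟨V, rfl⟩ := exists_smoothField_apply_eq v
    rw [ricci_apply, formAt_apply]
  calc inner ℝ (ricciOp x (Y x)) (Z x)
    _ = ∑ a, inner ℝ (frame x a) (Z x) * formAt ((leviCivitaAlgebra I M).ric Y) x (frame x a) := by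
      simp only [ricciOp, sum_inner, real_inner_smul_left, ricci_eq_formAt, mul_comm]
    _ = formAt ((leviCivitaAlgebra I M).ric Y) x (∑ a, inner ℝ (frame x a) (Z x) • frame x a) := by
      simp only [map_sum, map_smul, smul_eq_mul]
    _ = (leviCivitaAlgebra I M).ric Y Z x := by rw [(frame x).sum_repr', formAt_apply]

variable (I M) in
/-- The Ricci operator on smooth fields. -/
noncomputable def ricciField : SmoothField I M →ₗ[SmoothFun I M] SmoothField I M where
  toFun Y := ⟨fun x ↦ ricciOp x (Y x), contMDiff_of_inner fun Z ↦ by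
    simpa only [inner_ricciOp] using ((leviCivitaAlgebra I M).ric Y Z).contMDiff⟩
  map_add' X Y := by
    ext x
    refine smoothField_ext_inner fun Z ↦ ?_
    change inner ℝ (ricciOp x ((X + Y) x)) (Z x) =
      inner ℝ (ricciOp x (X x) + ricciOp x (Y x)) (Z x)
    simp only [inner_add_left, inner_ricciOp, map_add]
    rfl
  map_smul' r X := by
    ext x
    refine smoothField_ext_inner fun Z ↦ ?_
    change inner ℝ (ricciOp x ((r • X) x)) (Z x) = inner ℝ (r x • ricciOp x (X x)) (Z x)
    simp only [real_inner_smul_left, inner_ricciOp, map_smul]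
    rfl

theorem ricciField_apply (Y : SmoothField I M) (x : M) :
    ricciField I M Y x = ricciOp x (Y x) := rfl

theorem metricForm_ricciField (Y Z : SmoothField I M) :
    metricForm I M (ricciField I M Y) Z = (leviCivitaAlgebra I M).ric Y Z := by
  ext x
  exact inner_ricciOp Y Z x

theorem traceField_ricciField_apply (x : M) :
    traceField I M (ricciField I M) x = scalarCurvature I x := by
  rw [traceField_apply, LinearMap.trace_eq_sum_inner _ (frame x), scalarCurvature]
  refine Finset.sum_congr rfl fun a _ ↦ ?_
  obtain ⟨X, hX⟩ := exists_smoothField_apply_eq (frame x a)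
  rw [← hX, endAt_apply, ricciField_apply, real_inner_comm, inner_ricciOp, ricci_apply]

theorem contMDiff_scalarCurvature : CMDiff ∞ (scalarCurvature I (M := M)) :=
  (traceField I M (ricciField I M)).contMDiff.congr fun x ↦ (traceField_ricciField_apply x).symm

end Ricci

section Structure

variable {E : Type*} [NormedAddCommGroup E] [NormedSpace ℝ E]
  {H : Type*} [TopologicalSpace H] {I : ModelWithCorners ℝ E H}
  {M : Type*} [TopologicalSpace M] [ChartedSpace H M] [IsManifold I ∞ M]
  {n s : ℕ} {f Q : Π x : M, TangentSpace I x →L[ℝ] TangentSpace I x}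
  {ξ : Fin s → Π x : M, TangentSpace I x} {η : Fin s → Π x : M, TangentSpace I x →L[ℝ] ℝ}
  {β : M → ℝ}

theorem IsFramedWeakF.f_ξ (h : IsFramedWeakF n s f Q ξ η) (x : M) (i : Fin s) :
    f x (ξ i x) = 0 := by
  have f_f_ξ : f x (f x (ξ i x)) = 0 := by simp [h.sq, h.Q_ξ, h.η_ξ]
  simpa [f_f_ξ, h.Q_ξ] using h.cube x (ξ i x)

theorem IsFramedWeakF.η_f (h : IsFramedWeakF n s f Q ξ η) (x : M) (i : Fin s)
    (u : TangentSpace I x) : η i x (f x u) = 0 := by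
  simpa [h.f_ξ] using h.invariant x (u - ∑ j, η j x u • ξ j x) (fun i ↦ by simp [h.η_ξ]) i

theorem IsFramedWeakF.eq_sum_of_f_eq_zero (h : IsFramedWeakF n s f Q ξ η) {x : M}
    {u : TangentSpace I x} (hu : f x u = 0) : u = ∑ i, η i x u • ξ i x := by
  have Q_u : Q x u = ∑ i, η i x u • ξ i x := by
    have := h.sq x u
    rwa [hu, map_zero, eq_comm, neg_add_eq_zero] at this
  refine (h.nonsingular_Q x).injective ?_
  simp only [Q_u, map_sum, map_smul, h.Q_ξ]

variable [RiemannianBundle (fun x : M ↦ TangentSpace I x)]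

theorem IsWeakMetricF.η_eq_inner (h : IsWeakMetricF n s f Q ξ η) (x : M) (i : Fin s)
    (u : TangentSpace I x) : η i x u = inner ℝ (ξ i x) u := by
  have compatible_ξ := h.compatible x u (ξ i x)
  simp only [h.f_ξ, h.Q_ξ, h.η_ξ, inner_zero_right, mul_ite, mul_one, mul_zero,
    Finset.sum_ite_eq', Finset.mem_univ, if_true] at compatible_ξ
  rw [real_inner_comm]
  linarith

variable [FiniteDimensional ℝ E]
  [IsContMDiffRiemannianBundle I ∞ E (fun x : M ↦ TangentSpace I x)]

theorem IsWeakKenmotsuF.extDeriv_η_ξ (h : IsWeakKenmotsuF n s f Q ξ η β)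
    {X : Π x : M, TangentSpace I x} (hX : CMDiff ∞ (T% X)) (x : M) (i j : Fin s) :
    extDeriv (η j) X (ξ i) x = 0 := by
  have f_ξ : (fun y ↦ f y (ξ i y)) = 0 := funext fun y ↦ h.f_ξ y i
  have normal := congrArg (η j x) (h.normal X (ξ i) hX (h.smooth_ξ i) x)
  simpa [nijenhuis, f_ξ, mlieBracket_zero_right, h.η_f, h.η_ξ] using normal

theorem IsWeakKenmotsuF.f_leviCivita_ξ (h : IsWeakKenmotsuF n s f Q ξ η β)
    {X : Π x : M, TangentSpace I x} (hX : CMDiff ∞ (T% X)) (x : M) (i : Fin s) :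
    f x (leviCivita (ξ i) x (X x)) = β x • f x (X x) := by
  have f_ξ : (fun y ↦ f y (ξ i y)) = 0 := funext fun y ↦ h.f_ξ y i
  have etaBar_ξ : etaBar η x (ξ i x) = 1 := by simp [etaBar, h.η_ξ]
  have inner_f_ξ : inner ℝ (f x (X x)) (ξ i x) = 0 := by
    rw [real_inner_comm, ← h.η_eq_inner, h.η_f]
  simpa [nablaEndo, f_ξ, etaBar_ξ, inner_f_ξ, CovariantDerivative.zero] using
    h.kenmotsu X (ξ i) hX (h.smooth_ξ i) x

variable [T2Space M]

/-- Both terms together are `-2 dη^j(X, ξ_i)` for a field `X` with value `u` at `x`. -/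
theorem IsWeakKenmotsuF.inner_leviCivita_ξ_add (h : IsWeakKenmotsuF n s f Q ξ η β)
    {x : M} (u : TangentSpace I x) (i j : Fin s) :
    inner ℝ (leviCivita (ξ i) x u) (ξ j x) + inner ℝ (leviCivita (ξ j) x (ξ i x)) u = 0 := by
  obtain ⟨X, rfl⟩ := exists_smoothField_apply_eq u
  have hξ (i) : MDiffAt (T% (ξ i)) x := (h.smooth_ξ i).mdifferentiable (by simp) x
  have η_ξ : (fun y ↦ η j y (ξ i y)) = fun _ ↦ if j = i then 1 else 0 :=
    funext fun y ↦ h.η_ξ y j i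
  have closed := h.extDeriv_η_ξ X.contMDiff x i j
  have η_X : (fun y ↦ η j y (X y)) = fun y ↦ inner ℝ (ξ j y) (X y) :=
    funext fun y ↦ h.η_eq_inner y j (X y)
  rw [extDeriv, η_ξ, mvfderiv_const, η_X, leviCivita_metric (hξ i) (hξ j) X.mdifferentiableAt,
    h.η_eq_inner, ← leviCivita_torsion X.mdifferentiableAt (hξ i), inner_sub_right,
    zero_apply] at closed
  rw [real_inner_comm (ξ j x)]
  linarith

theorem IsWeakKenmotsuF.leviCivita_ξ_eq_add (h : IsWeakKenmotsuF n s f Q ξ η β) {x : M}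
    (u : TangentSpace I x) (i : Fin s) :
    leviCivita (ξ i) x u = β x • (u - ∑ p, η p x u • ξ p x)
      + ∑ p, inner ℝ (leviCivita (ξ i) x u) (ξ p x) • ξ p x := by
  have f_eq_zero : f x (leviCivita (ξ i) x u - β x • u) = 0 := by
    obtain ⟨X, rfl⟩ := exists_smoothField_apply_eq u
    rw [map_sub, map_smul, h.f_leviCivita_ξ X.contMDiff, sub_self]
  have expansion := h.eq_sum_of_f_eq_zero f_eq_zero
  simp only [map_sub, map_smul, h.η_eq_inner _ _ (leviCivita (ξ i) x u), sub_smul, smul_eq_mul,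
    mul_smul, Finset.sum_sub_distrib, ← Finset.smul_sum, sub_eq_iff_eq_add] at expansion
  simp only [real_inner_comm (ξ _ x)]
  refine expansion.trans ?_
  rw [smul_sub]
  abel

/-- With `c i j k = ⟪∇_{ξ_i} ξ_j, ξ_k⟫`, normality gives `c i j k = -c j k i`, and three cyclic
steps give `c i j k = -c i j k`. -/
theorem IsWeakKenmotsuF.leviCivita_ξ (h : IsWeakKenmotsuF n s f Q ξ η β) {x : M}
    (u : TangentSpace I x) (i : Fin s) :
    leviCivita (ξ i) x u = β x • (u - ∑ p, η p x u • ξ p x) := by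
  have inner_leviCivita_ξ_ξ (i j k : Fin s) :
      inner ℝ (leviCivita (ξ j) x (ξ i x)) (ξ k x) = 0 := by
    linarith [h.inner_leviCivita_ξ_add (ξ i x) j k, h.inner_leviCivita_ξ_add (ξ j x) k i,
      h.inner_leviCivita_ξ_add (ξ k x) i j]
  have leviCivita_ξ_ξ (j) : leviCivita (ξ j) x (ξ i x) = 0 := by
    rw [h.leviCivita_ξ_eq_add]
    simp [h.η_ξ, inner_leviCivita_ξ_ξ]
  have inner_leviCivita_ξ (j) : inner ℝ (leviCivita (ξ i) x u) (ξ j x) = 0 := by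
    simpa [leviCivita_ξ_ξ] using h.inner_leviCivita_ξ_add u i j
  rw [h.leviCivita_ξ_eq_add]
  simp [inner_leviCivita_ξ]

end Structure

section Kenmotsu

variable {E : Type*} [NormedAddCommGroup E] [NormedSpace ℝ E] [FiniteDimensional ℝ E]
  {H : Type*} [TopologicalSpace H] {I : ModelWithCorners ℝ E H}
  {M : Type*} [TopologicalSpace M] [ChartedSpace H M] [IsManifold I ∞ M]
  [RiemannianBundle (fun x : M ↦ TangentSpace I x)]
  [IsContMDiffRiemannianBundle I ∞ E (fun x : M ↦ TangentSpace I x)]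

/-- Orthonormal smooth vector fields `ξ_i`, with dual 1-forms `η^i`, such that
`∇_X ξ_i = β (X - ∑ p, η^p(X) ξ_p)` for a constant `β`: the part of a weak `β`-Kenmotsu
`f`-structure that determines the curvature in the directions `ξ_i`. -/
structure IsKenmotsuFrame {s : ℕ} (ξ : Fin s → Π x : M, TangentSpace I x)
    (η : Fin s → Π x : M, TangentSpace I x →L[ℝ] ℝ) (β : ℝ) : Prop where
  smooth_ξ : ∀ i, CMDiff ∞ (T% (ξ i))
  η_eq_inner : ∀ x i (u : TangentSpace I x), η i x u = inner ℝ (ξ i x) u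
  η_ξ : ∀ x i j, η i x (ξ j x) = if i = j then 1 else 0
  leviCivita_ξ : ∀ x (u : TangentSpace I x) i,
    leviCivita (ξ i) x u = β • (u - ∑ p, η p x u • ξ p x)

variable {s : ℕ} {ξ : Fin s → Π x : M, TangentSpace I x}
  {η : Fin s → Π x : M, TangentSpace I x →L[ℝ] ℝ} {β : ℝ}

/-- The `i`-th member of a Kenmotsu frame, as a smooth vector field. -/
def IsKenmotsuFrame.field (h : IsKenmotsuFrame ξ η β) (i : Fin s) : SmoothField I M :=
  ⟨ξ i, h.smooth_ξ i⟩

theorem IsKenmotsuFrame.sum_field_apply (h : IsKenmotsuFrame ξ η β) (x : M) :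
    (∑ i, h.field i) x = xiBar ξ x :=
  smoothField_sum_apply ..

variable [T2Space M]

theorem IsKenmotsuFrame.evalHom_g_sum_field (h : IsKenmotsuFrame ξ η β) (X : SmoothField I M)
    (x : M) :
    evalHom I x ((leviCivitaAlgebra I M).g (∑ i, h.field i) X) = etaBar η x (X x) := by
  refine (metricForm_apply _ X x).trans ?_
  rw [h.sum_field_apply, xiBar, sum_inner, etaBar, sum_apply]
  exact Finset.sum_congr rfl fun i _ ↦ (h.η_eq_inner x i _).symm

theorem IsKenmotsuFrame.proj_field_apply (h : IsKenmotsuFrame ξ η β) (X : SmoothField I M)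
    (x : M) :
    (leviCivitaAlgebra I M).proj h.field X x = X x - ∑ p, η p x (X x) • ξ p x := by
  have := congrArg (evalField x) ((leviCivitaAlgebra I M).proj_apply h.field X)
  simp only [map_sub, map_sum, map_smulₛₗ] at this
  refine this.trans (congrArg (X x - ·) (Finset.sum_congr rfl fun p _ ↦ ?_))
  exact congrArg (· • ξ p x) (h.η_eq_inner x p (X x)).symm

theorem IsKenmotsuFrame.leviCivitaAlgebra_isKenmotsuFrame (h : IsKenmotsuFrame ξ η β) :
    (leviCivitaAlgebra I M).IsKenmotsuFrame h.field (ContMDiffMap.const β) where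
  g_self i := by
    ext x
    exact (h.η_eq_inner x i _).symm.trans ((h.η_ξ x i i).trans (if_pos rfl))
  g_of_ne i j hij := by
    ext x
    exact (h.η_eq_inner x i _).symm.trans ((h.η_ξ x i j).trans (if_neg hij))
  D_eq_zero X := derivation_const X β
  cov_eq X i := by
    ext x
    exact (h.leviCivita_ξ x (X x) i).trans (congrArg (β • ·) (h.proj_field_apply X x).symm)

theorem IsKenmotsuFrame.evalHom_trace_proj_field (h : IsKenmotsuFrame ξ η β) {m : ℕ}
    (dim : finrank ℝ E = m + s) (x : M) :
    evalHom I x ((leviCivitaAlgebra I M).trace ((leviCivitaAlgebra I M).proj h.field)) = m := by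
  have endAt_proj : endAt ((leviCivitaAlgebra I M).proj h.field) x =
      LinearMap.id - ∑ i, (η i x).toLinearMap.smulRight (ξ i x) := by
    ext u
    obtain ⟨X, rfl⟩ := exists_smoothField_apply_eq u
    rw [endAt_apply, h.proj_field_apply]
    simp
  refine (traceField_apply _ x).trans ?_
  rw [endAt_proj, map_sub, LinearMap.trace_id, map_sum]
  have finrank_tangentSpace : finrank ℝ (TangentSpace I x) = m + s := dim
  simp [LinearMap.trace_smulRight, h.η_ξ, finrank_tangentSpace]

theorem IsKenmotsuFrame.curvature_ξ (h : IsKenmotsuFrame ξ η β) (X Y : SmoothField I M)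
    (i : Fin s) (x : M) :
    curvature X Y (ξ i) x = β ^ 2 • (etaBar η x (X x) • Y x - etaBar η x (Y x) • X x
      + ∑ p, (etaBar η x (Y x) * η p x (X x) - etaBar η x (X x) * η p x (Y x)) • ξ p x) := by
  have curv_ξ := congrArg (evalField x)
    (h.leviCivitaAlgebra_isKenmotsuFrame.curv_xi X Y i)
  simp only [map_smulₛₗ, map_sub, map_pow, evalField_apply, h.proj_field_apply,
    h.evalHom_g_sum_field, evalHom_const] at curv_ξ
  refine (curvature_apply X Y (h.field i) x).trans (curv_ξ.trans (congrArg (β ^ 2 • ·) ?_))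
  simp only [sub_smul, mul_smul, smul_sub, Finset.sum_sub_distrib, ← Finset.smul_sum]
  abel

theorem IsKenmotsuFrame.ricciOp_ξ (h : IsKenmotsuFrame ξ η β) {m : ℕ}
    (dim : finrank ℝ E = m + s) (i : Fin s) (x : M) :
    ricciOp x (ξ i x) = (-m * β ^ 2) • xiBar ξ x := by
  have ricci_ξ := congrArg (evalField x)
    (h.leviCivitaAlgebra_isKenmotsuFrame.ricciOp_xi metricForm_ricciField i)
  simp only [map_smulₛₗ, map_neg, map_mul, map_pow, evalField_apply, h.sum_field_apply,
    h.evalHom_trace_proj_field dim, evalHom_const, ← neg_mul] at ricci_ξ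
  exact ricci_ξ

theorem IsKenmotsuFrame.nablaEndo_ricciOp (h : IsKenmotsuFrame ξ η β) {m : ℕ}
    (dim : finrank ℝ E = m + s) (X : SmoothField I M) (i : Fin s) (x : M) :
    nablaEndo ricciOp (ξ i) X x = (-2 * β) • ricciOp x (X x)
      - (2 * m * β ^ 3) • ((s : ℝ) • (X x - ∑ j, η j x (X x) • ξ j x)
        + etaBar η x (X x) • xiBar ξ x) := by
  have cov_ricci := congrArg (evalField x)
    (h.leviCivitaAlgebra_isKenmotsuFrame.cov_ricciOp metricForm_ricciField X i)
  simp only [map_smulₛₗ, map_neg, map_mul, map_pow, map_sub, map_add, map_natCast, map_ofNat,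
    evalField_apply, h.sum_field_apply, h.proj_field_apply, h.evalHom_g_sum_field,
    h.evalHom_trace_proj_field dim, evalHom_const, Fintype.card_fin, ← neg_mul] at cov_ricci
  exact cov_ricci

theorem IsKenmotsuFrame.mvfderiv_scalarCurvature (h : IsKenmotsuFrame ξ η β) {m : ℕ}
    (dim : finrank ℝ E = m + s) (i : Fin s) (x : M) :
    d% (scalarCurvature I (M := M)) x (ξ i x) =
      -2 * β * (scalarCurvature I x + s * m * (m + 1) * β ^ 2) := by
  have D_trace := congrArg (evalHom I x)
    (h.leviCivitaAlgebra_isKenmotsuFrame.D_trace_ricciOp metricForm_ricciField i)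
  simp only [map_neg, map_mul, map_pow, map_add, map_natCast, map_ofNat, map_one,
    h.evalHom_trace_proj_field dim, evalHom_const, Fintype.card_fin] at D_trace
  have scalar : scalarCurvature I = ⇑(traceField I M (ricciField I M)) :=
    funext fun x ↦ (traceField_ricciField_apply x).symm
  rw [scalar]
  exact (derivation_apply (h.field i) _ x).symm.trans D_trace

theorem IsWeakKenmotsuF.isKenmotsuFrame {n : ℕ}
    {f Q : Π x : M, TangentSpace I x →L[ℝ] TangentSpace I x}
    (h : IsWeakKenmotsuF n s f Q ξ η (fun _ ↦ β)) : IsKenmotsuFrame ξ η β where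
  smooth_ξ := h.smooth_ξ
  η_eq_inner := h.η_eq_inner
  η_ξ := h.η_ξ
  leviCivita_ξ _ := h.leviCivita_ξ

end Kenmotsu

end WeakKenmotsu

theorem proposition2p3_general
    {E : Type*} [NormedAddCommGroup E] [NormedSpace ℝ E] [FiniteDimensional ℝ E]
    {H : Type*} [TopologicalSpace H] {I : ModelWithCorners ℝ E H}
    {M : Type*} [TopologicalSpace M] [ChartedSpace H M] [IsManifold I ∞ M] [T2Space M]
    [RiemannianBundle (fun x : M ↦ TangentSpace I x)]
    [IsContMDiffRiemannianBundle I ∞ E (fun x : M ↦ TangentSpace I x)]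
    {m s : ℕ} (dim : finrank ℝ E = m + s) {ξ : Fin s → Π x : M, TangentSpace I x}
    {η : Fin s → Π x : M, TangentSpace I x →L[ℝ] ℝ} {β : ℝ}
    (h : WeakKenmotsu.IsKenmotsuFrame ξ η β) :
    (∀ (i : Fin s) (X Y : Π x : M, TangentSpace I x), CMDiff ∞ (T% X) → CMDiff ∞ (T% Y) → ∀ x,
      WeakKenmotsu.curvature X Y (ξ i) x =
        β ^ 2 • (WeakKenmotsu.etaBar η x (X x) • Y x - WeakKenmotsu.etaBar η x (Y x) • X x
          + ∑ p, (WeakKenmotsu.etaBar η x (Y x) * η p x (X x)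
              - WeakKenmotsu.etaBar η x (X x) * η p x (Y x)) • ξ p x)) ∧
    (∀ (i : Fin s) (x : M),
      WeakKenmotsu.ricciOp x (ξ i x) = (-m * β ^ 2) • WeakKenmotsu.xiBar ξ x) ∧
    (∀ (i : Fin s) (X : Π x : M, TangentSpace I x), CMDiff ∞ (T% X) →
      MDiff (T% (fun x ↦ WeakKenmotsu.ricciOp x (X x))) ∧
      ∀ x, WeakKenmotsu.nablaEndo WeakKenmotsu.ricciOp (ξ i) X x =
        (-2 * β) • WeakKenmotsu.ricciOp x (X x)
          - (2 * m * β ^ 3) • ((s : ℝ) • (X x - ∑ j, η j x (X x) • ξ j x)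
            + WeakKenmotsu.etaBar η x (X x) • WeakKenmotsu.xiBar ξ x)) ∧
    (∀ i : Fin s, MDiff (WeakKenmotsu.scalarCurvature I (M := M)) ∧
      ∀ x, d% (WeakKenmotsu.scalarCurvature I (M := M)) x (ξ i x) =
        -2 * β * (WeakKenmotsu.scalarCurvature I x + s * m * (m + 1) * β ^ 2)) :=
  ⟨fun i X Y hX hY ↦ h.curvature_ξ ⟨X, hX⟩ ⟨Y, hY⟩ i,
    h.ricciOp_ξ dim,
    fun i X hX ↦ ⟨(WeakKenmotsu.ricciField I M ⟨X, hX⟩).mdifferentiable,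
      h.nablaEndo_ricciOp dim ⟨X, hX⟩ i⟩,
    fun i ↦ ⟨WeakKenmotsu.contMDiff_scalarCurvature.mdifferentiable (by simp),
      h.mvfderiv_scalarCurvature dim i⟩⟩

theorem proposition2p3
    {E : Type*} [NormedAddCommGroup E] [NormedSpace ℝ E] [FiniteDimensional ℝ E]
    {H : Type*} [TopologicalSpace H] {I : ModelWithCorners ℝ E H}
    {M : Type*} [TopologicalSpace M] [ChartedSpace H M] [IsManifold I ∞ M]
    [BoundarylessManifold I M] [T2Space M] [SecondCountableTopology M]
    [RiemannianBundle (fun x : M ↦ TangentSpace I x)]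
    [IsContMDiffRiemannianBundle I ∞ E (fun x : M ↦ TangentSpace I x)]
    (n s : ℕ) (f Q : Π x : M, TangentSpace I x →L[ℝ] TangentSpace I x)
    (ξ : Fin s → Π x : M, TangentSpace I x)
    (η : Fin s → Π x : M, TangentSpace I x →L[ℝ] ℝ) (β : ℝ)
    (h : WeakKenmotsu.IsWeakKenmotsuF n s f Q ξ η (fun _ ↦ β)) :
    (∀ (i : Fin s) (X Y : Π x : M, TangentSpace I x), CMDiff ∞ (T% X) → CMDiff ∞ (T% Y) → ∀ x,
      WeakKenmotsu.curvature X Y (ξ i) x =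
        β ^ 2 • (WeakKenmotsu.etaBar η x (X x) • Y x - WeakKenmotsu.etaBar η x (Y x) • X x
          + ∑ p, (WeakKenmotsu.etaBar η x (Y x) * η p x (X x)
              - WeakKenmotsu.etaBar η x (X x) * η p x (Y x)) • ξ p x)) ∧
    (∀ (i : Fin s) (x : M),
      WeakKenmotsu.ricciOp x (ξ i x) = (-2 * n * β ^ 2) • WeakKenmotsu.xiBar ξ x) ∧
    (∀ (i : Fin s) (X : Π x : M, TangentSpace I x), CMDiff ∞ (T% X) →
      MDiff (T% (fun x ↦ WeakKenmotsu.ricciOp x (X x))) ∧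
      ∀ x, WeakKenmotsu.nablaEndo WeakKenmotsu.ricciOp (ξ i) X x =
        (-2 * β) • WeakKenmotsu.ricciOp x (X x)
          - (4 * n * β ^ 3) • ((s : ℝ) • (X x - ∑ j, η j x (X x) • ξ j x)
            + WeakKenmotsu.etaBar η x (X x) • WeakKenmotsu.xiBar ξ x)) ∧
    (∀ i : Fin s, MDiff (WeakKenmotsu.scalarCurvature I (M := M)) ∧
      ∀ x, d% (WeakKenmotsu.scalarCurvature I (M := M)) x (ξ i x) =
        -2 * β * (WeakKenmotsu.scalarCurvature I x + 2 * s * n * (2 * n + 1) * β ^ 2)) := by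
  rw [show (4 : ℝ) = 2 * 2 by norm_num]
  simpa [mul_assoc, mul_left_comm] using proposition2p3_general h.dim h.isKenmotsuFrame
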